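/- **Setting.** There are $N$ arms and $1\le K\le N$. At each time $t=0,1,2,\dots$ arm $i\in[N]$ has a reward $r_{i,t}\in[0,1]$ and a cost $c_{i,t}\in[c_{\min},1]$, where $c_{\min}>0$. The vectors $(r_{i,t},c_{i,t})_{i\in[N]}$ are independent and identically distributed over $t$, with means $\mu_r^i>0$ and $\mu_c^i$. Put $\mu^i=\mu_r^i/\mu_c^i$, let $a^\ast$ be the set of the $K$ arms with the largest $\mu^i$, and let $$\Delta_{\min}=\sum_{j\in a^\ast}\mu^j-\max_{a\neq a^\ast,\ |a|=K}\ \sum_{j\in a}\mu^j$$ be the gap to the second best set of $K$ arms. Assume $\Delta_{\min}>0$ (if $K=N$, there is no other set, and $\Delta_{\min}:=\sum_j\mu^j$). A strategy with budget $B>0$ plays a set $a_t$ of $K$ arms in each round $t=1,2,\dots$ and pays $\sum_{i\in a_t}c_{i,t}$. It stops at the first round $\tau(B)$ whose cost exceeds the remaining budget, and its gain is $G(B)=\sum_{t=1}^{\tau(B)-1}\sum_{i\in a_t}r_{i,t}$. **UCB-MB.** Before the game (time $0$) all $N$ arms are observed once, at no cost and with no gain. In round $t\ge1$ let $n_{i,t}$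 be the number of observations of arm $i$ so far (including the one at time $0$), let $\bar\mu_{r,t}^i,\bar\mu_{c,t}^i$ be the sample means of its observed rewards and costs, and let $\varepsilon_{i,t}=\sqrt{(K+1)\log t/n_{i,t}}$ and $$U_{i,t}=\frac{\bar\mu_{r,t}^i}{\bar\mu_{c,t}^i}+e_{i,t},\qquad e_{i,t}=\begin{cases}\dfrac{\varepsilon_{i,t}(1+1/c_{\min})}{c_{\min}-\varepsilon_{i,t}}&\text{if }\varepsilon_{i,t}<c_{\min},\\[2mm]+\infty&\text{otherwise.}\end{cases}$$ The algorithm plays $K$ arms with the $K$ largest $U_{i,t}$, with ties broken by any fixed measurable rule. Its expected regret is $\mathcal R(B)=\mathbb E[G_{\mathcal A^\ast}(B)]-\mathbb E[G_{\text{UCB-MB}}(B)]$, where $\mathcal A^\ast$ plays $a^\ast$ in every round. **Theorem.** There are $c_1,c_2,c_3>0$, which depend only on $N$, $K$, $c_{\min}$, $\Delta_{\min}$, $(\mu_r^i)_i$ and $(\mu_c^i)_i$, such that both expected gains exist and $$\mathcal R(B)\le c_1+c_2\log(B+c_3)\qquad\text{for all } B>0.$$ Moreover this bound is $O(NK^4\log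 B)$: there is a $C$, which depends only on $c_{\min}$ and $\Delta_{\min}$, such that $c_1+c_2\log(B+c_3)\le C\,NK^4\log B$ for all $B\ge2$. -/

import Mathlib

open MeasureTheory ProbabilityTheory

noncomputable section

namespace BudgetedBandit

/-- `r t i ω` and `c t i ω` are the reward and the cost of arm `i` at time `t`.
The vectors (rewards and costs of all arms at time `t`), `t = 0, 1, 2, …`, are independent and
identically distributed; rewards lie in `[0, 1]`, costs in `[cmin, 1]`; `μr` and `μc` are the
(positive) mean rewards and costs.  Nothing is assumed on the dependence between different arms,
or between reward and cost of an arm, at one and the same time. -/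
structure IsStochasticBandit {Ω : Type*} [MeasurableSpace Ω] (P : Measure Ω) {N : ℕ}
    (cmin : ℝ) (μr μc : Fin N → ℝ) (r c : ℕ → Fin N → Ω → ℝ) : Prop where
  cmin_pos : 0 < cmin
  measurable_reward : ∀ t i, Measurable (r t i)
  measurable_cost : ∀ t i, Measurable (c t i)
  indep : iIndepFun (fun (t : ℕ) (ω : Ω) (i : Fin N) => (r t i ω, c t i ω)) P
  ident : ∀ t, IdentDistrib (fun (ω : Ω) (i : Fin N) => (r t i ω, c t i ω))
    (fun (ω : Ω) (i : Fin N) => (r 0 i ω, c 0 i ω)) P P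
  reward_mem : ∀ t i, ∀ᵐ ω ∂P, r t i ω ∈ Set.Icc (0 : ℝ) 1
  cost_mem : ∀ t i, ∀ᵐ ω ∂P, c t i ω ∈ Set.Icc cmin 1
  mean_reward : ∀ i, ∫ ω, r 0 i ω ∂P = μr i
  mean_cost : ∀ i, ∫ ω, c 0 i ω ∂P = μc i
  mean_reward_pos : ∀ i, 0 < μr i

/-- `a` is a set of `K` arms with the `K` largest values of `U`. -/
def IsTopK {N : ℕ} {α : Type*} [LE α] (K : ℕ) (U : Fin N → α) (a : Finset (Fin N)) : Prop :=
  a.card = K ∧ ∀ i ∈ a, ∀ j ∉ a, U j ≤ U i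

/-- A (measurable, possibly time-dependent) way to choose `K` arms with the `K` largest indices;
it only leaves open how ties are broken. -/
structure IsTopKRule {N : ℕ} (K : ℕ) (sel : ℕ → (Fin N → EReal) → Finset (Fin N)) : Prop where
  isTopK : ∀ t U, IsTopK K U (sel t U)
  measurable : ∀ t a, MeasurableSet {U | sel t U = a}

/-- The bang-per-buck ratios. -/
def ratio {N : ℕ} (μr μc : Fin N → ℝ) (i : Fin N) : ℝ := μr i / μc i

/-- The gap between `astar` and the second best set of `K` arms, with respect to the sum of the
values `μ`.  (If `K = N` there is no other set, and the value is `∑ j ∈ astar, μ j`.) -/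
def gapMin {N : ℕ} (K : ℕ) (μ : Fin N → ℝ) (astar : Finset (Fin N)) : ℝ :=
  ∑ j ∈ astar, μ j -
    sSup {x : ℝ | ∃ a : Finset (Fin N), a.card = K ∧ a ≠ astar ∧ x = ∑ j ∈ a, μ j}

/-- What the player has recorded: number of observations, sum of the observed rewards and sum of
the observed costs of every arm. -/
structure Stats (N : ℕ) where
  count : Fin N → ℕ
  rewardSum : Fin N → ℝ
  costSum : Fin N → ℝ

/-- Statistics after playing all arms once. -/
def Stats.init {N : ℕ} (ρ κ : Fin N → ℝ) : Stats N where
  count := fun _ => 1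
  rewardSum := ρ
  costSum := κ

/-- Update after playing the set `a` and observing rewards `ρ i` and costs `κ i`, `i ∈ a`. -/
def Stats.update {N : ℕ} (S : Stats N) (a : Finset (Fin N)) (ρ κ : Fin N → ℝ) : Stats N where
  count := fun i => if i ∈ a then S.count i + 1 else S.count i
  rewardSum := fun i => if i ∈ a then S.rewardSum i + ρ i else S.rewardSum i
  costSum := fun i => if i ∈ a then S.costSum i + κ i else S.costSum i

/-- Exploration term in round `t` of an arm observed `n` times.  It is `⊤` as long as
`ε = √((K+1) log t / n)` is not below `cmin`, i.e. as long as the confidence interval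
`[mean cost - ε, mean cost + ε]` does not yield an upper confidence bound. -/
def exploration (K : ℕ) (cmin : ℝ) (t n : ℕ) : EReal :=
  let ε : ℝ := √(((K : ℝ) + 1) * Real.log t / n)
  if ε < cmin then ((ε * (1 + 1 / cmin) / (cmin - ε) : ℝ) : EReal) else ⊤

/-- Upper confidence bound of arm `i` in round `t`: ratio of the sample means of rewards and costs,
plus exploration term. -/
def ucbIndex {N : ℕ} (K : ℕ) (cmin : ℝ) (t : ℕ) (S : Stats N) (i : Fin N) : EReal :=
  (((S.rewardSum i / S.count i) / (S.costSum i / S.count i) : ℝ) : EReal) +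
    exploration K cmin t (S.count i)

/-- Statistics of the algorithm after round `t`, along the reward and cost sequences `ρ`, `κ`.
Time `0` is the initial play of all arms; the rounds of the game are `t = 1, 2, …`. -/
def ucbStats {N : ℕ} (K : ℕ) (cmin : ℝ) (sel : ℕ → (Fin N → EReal) → Finset (Fin N))
    (ρ κ : ℕ → Fin N → ℝ) : ℕ → Stats N
  | 0 => Stats.init (ρ 0) (κ 0)
  | t + 1 =>
      (ucbStats K cmin sel ρ κ t).update
        (sel (t + 1) (ucbIndex K cmin (t + 1) (ucbStats K cmin sel ρ κ t)))
        (ρ (t + 1)) (κ (t + 1))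

/-- The set of arms that the algorithm UCB-MB plays at time `t`. -/
def ucbPlay {N : ℕ} (K : ℕ) (cmin : ℝ) (sel : ℕ → (Fin N → EReal) → Finset (Fin N))
    (ρ κ : ℕ → Fin N → ℝ) : ℕ → Finset (Fin N)
  | 0 => Finset.univ
  | t + 1 => sel (t + 1) (ucbIndex K cmin (t + 1) (ucbStats K cmin sel ρ κ t))

/-- Total cost of rounds `1, …, t` if the set `a s` is played in round `s`. -/
def spent {N : ℕ} (a : ℕ → Finset (Fin N)) (κ : ℕ → Fin N → ℝ) (t : ℕ) : ℝ :=
  ∑ s ∈ Finset.Icc 1 t, ∑ i ∈ a s, κ s i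

/-- The first round whose cost exceeds the remaining budget. -/
def stoppingTime {N : ℕ} (B : ℝ) (a : ℕ → Finset (Fin N)) (κ : ℕ → Fin N → ℝ) : ℕ :=
  sInf {t : ℕ | 1 ≤ t ∧ B < spent a κ t}

/-- Sum of the rewards collected before the stopping time. -/
def gain {N : ℕ} (B : ℝ) (a : ℕ → Finset (Fin N)) (ρ κ : ℕ → Fin N → ℝ) : ℝ :=
  ∑ t ∈ Finset.Ico 1 (stoppingTime B a κ), ∑ i ∈ a t, ρ t i

/-- Gain of the strategy that plays the set `astar` in each round. -/
def optGain {Ω : Type*} {N : ℕ} (astar : Finset (Fin N)) (r c : ℕ → Fin N → Ω → ℝ) (B : ℝ)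
    (ω : Ω) : ℝ :=
  gain B (fun _ => astar) (fun t i => r t i ω) (fun t i => c t i ω)

/-- Gain of UCB-MB. -/
def ucbGain {Ω : Type*} {N : ℕ} (K : ℕ) (cmin : ℝ)
    (sel : ℕ → (Fin N → EReal) → Finset (Fin N)) (r c : ℕ → Fin N → Ω → ℝ) (B : ℝ)
    (ω : Ω) : ℝ :=
  gain B (ucbPlay K cmin sel (fun t i => r t i ω) (fun t i => c t i ω))
    (fun t i => r t i ω) (fun t i => c t i ω)

/-- Expected regret of UCB-MB. -/
def regret {Ω : Type*} [MeasurableSpace Ω] (P : Measure Ω) {N : ℕ} (K : ℕ) (cmin : ℝ)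
    (sel : ℕ → (Fin N → EReal) → Finset (Fin N)) (astar : Finset (Fin N))
    (r c : ℕ → Fin N → Ω → ℝ) (B : ℝ) : ℝ :=
  (∫ ω, optGain astar r c B ω ∂P) - ∫ ω, ucbGain K cmin sel r c B ω ∂P

end BudgetedBandit

end

/-! Both gains are compared with the reward `collected` up to and including the stopping round.
Whether round s+1 is entered depends only on costs of rounds up to s, and the set played there only
on outcomes before time s+1. Wald's identity therefore replaces rewards and costs by their means
(`IsStochasticBandit.integral_collected`). The cost collected in this way lies between B and B+K,
and including the last round changes the reward by at most K.

Let ρ be the ratio of total mean reward to total mean cost of `astar`. Constant play of `astar`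
gains at most ρ(B+K) in expectation (`integral_optGain_le`). Under UCB-MB, a round with `astar`
earns exactly ρ times its mean cost, while any other round earns at least 0 and costs at most K on
average. So its gain is at least ρ(B - K E) - K, where E is the expected number of rounds with
another set (`le_integral_ucbGain`). Since ρ ≤ 1/cmin, the regret is at most K + (K/cmin)(1+E). This
never uses that `astar` maximizes ρ.

It remains to show that E is logarithmic (`IsStochasticBandit.integral_suboptimal_le`). A wrong set
contains some i outside `astar` and omits some j in `astar`, and the gap separates their ratios by
at least Δmin. If all sample means are within their confidence radius, i can beat j only while its
own radius is not small, that is, while i has O(log T) observations (`exists_count_le`). Each arm is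
played at most that often with so few observations. Sample means over a random number of adaptively
chosen draws are controlled by an exponential supermartingale and a union bound over the number of
draws; the failure probabilities are summable over the rounds. -/

open MeasureTheory ProbabilityTheory

noncomputable section

namespace BudgetedBandit

/-! ### Stopping times and the budget along one path -/

section Stopping

variable {N K : ℕ} {cmin B : ℝ} {a : ℕ → Finset (Fin N)} {κ : ℕ → Fin N → ℝ}

theorem spent_zero (a : ℕ → Finset (Fin N)) (κ : ℕ → Fin N → ℝ) : spent a κ 0 = 0 := by
  simp [spent]

theorem spent_succ (a : ℕ → Finset (Fin N)) (κ : ℕ → Fin N → ℝ) (t : ℕ) :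
    spent a κ (t + 1) = spent a κ t + ∑ i ∈ a (t + 1), κ (t + 1) i := by
  simp [spent, Finset.sum_Icc_succ_top]

theorem sum_mem_Icc {s : Finset (Fin N)} (hs : s.card = K) {lo : ℝ} {w : Fin N → ℝ}
    (hw : ∀ i, w i ∈ Set.Icc lo 1) : ∑ i ∈ s, w i ∈ Set.Icc ((K : ℝ) * lo) K := by
  constructor
  · have := Finset.card_nsmul_le_sum s w lo fun i _ => (hw i).1
    simpa [hs, nsmul_eq_mul] using this
  · have := Finset.sum_le_card_nsmul s w 1 fun i _ => (hw i).2
    simpa [hs, nsmul_eq_mul] using this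

theorem spent_monotone (hcm : 0 < cmin) (hκ : ∀ t i, κ t i ∈ Set.Icc cmin 1) :
    Monotone (spent a κ) := by
  refine monotone_nat_of_le_succ fun t => ?_
  rw [spent_succ]
  have : 0 ≤ ∑ i ∈ a (t + 1), κ (t + 1) i :=
    Finset.sum_nonneg fun i _ => hcm.le.trans (hκ _ i).1
  linarith

theorem le_spent (ha : ∀ t, (a (t + 1)).card = K) (hκ : ∀ t i, κ t i ∈ Set.Icc cmin 1) (t : ℕ) :
    (t : ℝ) * (K * cmin) ≤ spent a κ t := by
  induction t with
  | zero => simp [spent_zero]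
  | succ t ih =>
    rw [spent_succ]
    have := (sum_mem_Icc (ha t) (hκ (t + 1))).1
    push_cast
    linarith

/-- Costs are nonnegative, so the budget, once exceeded, stays exceeded. This turns the stopping
time into a condition on costs up to round t, which makes entering round t+1 a predictable event. -/
theorem lt_stoppingTime_iff (hcm : 0 < cmin) (hκ : ∀ t i, κ t i ∈ Set.Icc cmin 1)
    (ha : ∀ t, (a (t + 1)).card = K) (hK : 1 ≤ K) (hB : 0 ≤ B) (t : ℕ) :
    t < stoppingTime B a κ ↔ spent a κ t ≤ B := by
  have hpos : 0 < (K : ℝ) * cmin := mul_pos (by exact_mod_cast hK) hcm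
  -- Costs grow at least linearly, so the budget is eventually exceeded. Without this the infimum in
  -- ℕ would take its default value 0.
  have hne : {t : ℕ | 1 ≤ t ∧ B < spent a κ t}.Nonempty := by
    obtain ⟨n, hn⟩ := exists_nat_gt (B / (K * cmin))
    rw [div_lt_iff₀ hpos] at hn
    refine ⟨n, ?_, hn.trans_le (le_spent ha hκ n)⟩
    rcases Nat.eq_zero_or_pos n with rfl | h
    · simp at hn; linarith
    · exact h
  constructor
  · intro h
    have := Nat.notMem_of_lt_sInf h
    rcases Nat.eq_zero_or_pos t with rfl | h0
    · simpa [spent_zero] using hB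
    · by_contra! h1
      exact this ⟨h0, h1⟩
  · intro h
    by_contra! h1
    have h2 := (Nat.sInf_mem hne).2
    exact absurd ((h2.trans_le (spent_monotone hcm hκ h1)).trans_le h) (lt_irrefl _)

/-- Total weight `w` of the arms played up to and including the stopping time, provided that
the stopping time is at most `T`. -/
def collected (B : ℝ) (a : ℕ → Finset (Fin N)) (κ w : ℕ → Fin N → ℝ) (T : ℕ) : ℝ :=
  ∑ s ∈ Finset.range T, if spent a κ s ≤ B then ∑ i ∈ a (s + 1), w (s + 1) i else 0

theorem stoppingTime_le (hcm : 0 < cmin) (hκ : ∀ t i, κ t i ∈ Set.Icc cmin 1)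
    (ha : ∀ t, (a (t + 1)).card = K) (hK : 1 ≤ K) (hB : 0 ≤ B) {T : ℕ}
    (hT : B < T * (K * cmin)) : stoppingTime B a κ ≤ T := by
  by_contra! h
  rw [lt_stoppingTime_iff hcm hκ ha hK hB] at h
  linarith [le_spent ha hκ T]

theorem stoppingTime_pos (hcm : 0 < cmin) (hκ : ∀ t i, κ t i ∈ Set.Icc cmin 1)
    (ha : ∀ t, (a (t + 1)).card = K) (hK : 1 ≤ K) (hB : 0 ≤ B) : 0 < stoppingTime B a κ := by
  rw [lt_stoppingTime_iff hcm hκ ha hK hB, spent_zero]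
  exact hB

theorem sum_range_ite_lt {n T : ℕ} (h : n ≤ T) (f : ℕ → ℝ) :
    ∑ s ∈ Finset.range T, (if s < n then f s else 0) = ∑ s ∈ Finset.range n, f s := by
  rw [← Finset.sum_filter]
  congr 1
  ext s
  simp only [Finset.mem_filter, Finset.mem_range]
  omega

theorem collected_eq (hcm : 0 < cmin) (hκ : ∀ t i, κ t i ∈ Set.Icc cmin 1)
    (ha : ∀ t, (a (t + 1)).card = K) (hK : 1 ≤ K) (hB : 0 ≤ B) {T : ℕ}
    (hT : B < T * (K * cmin)) (w : ℕ → Fin N → ℝ) :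
    collected B a κ w T =
      ∑ s ∈ Finset.range (stoppingTime B a κ), ∑ i ∈ a (s + 1), w (s + 1) i := by
  rw [← sum_range_ite_lt (stoppingTime_le hcm hκ ha hK hB hT)]
  simp only [lt_stoppingTime_iff hcm hκ ha hK hB, collected]

theorem gain_eq_sum_range (ρ : ℕ → Fin N → ℝ) :
    gain B a ρ κ =
      ∑ s ∈ Finset.range (stoppingTime B a κ - 1), ∑ i ∈ a (s + 1), ρ (s + 1) i := by
  rw [gain, Finset.sum_Ico_eq_sum_range]
  exact Finset.sum_congr rfl fun s _ => by rw [add_comm 1 s]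

/-- A sum over a deterministic range of rounds, from which measurability and integrability of the
gain can be read off. -/
theorem gain_eq_sum_ite (hcm : 0 < cmin) (hκ : ∀ t i, κ t i ∈ Set.Icc cmin 1)
    (ha : ∀ t, (a (t + 1)).card = K) (hK : 1 ≤ K) (hB : 0 ≤ B) {T : ℕ}
    (hT : B < T * (K * cmin)) (ρ : ℕ → Fin N → ℝ) :
    gain B a ρ κ = ∑ s ∈ Finset.range T,
      if spent a κ (s + 1) ≤ B then ∑ i ∈ a (s + 1), ρ (s + 1) i else 0 := by
  have h := stoppingTime_le hcm hκ ha hK hB hT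
  rw [gain_eq_sum_range, ← sum_range_ite_lt (show stoppingTime B a κ - 1 ≤ T by omega)]
  refine Finset.sum_congr rfl fun s _ => ?_
  have : s < stoppingTime B a κ - 1 ↔ spent a κ (s + 1) ≤ B := by
    rw [← lt_stoppingTime_iff hcm hκ ha hK hB]
    omega
  simp only [this]

theorem collected_eq_gain_add (hcm : 0 < cmin) (hκ : ∀ t i, κ t i ∈ Set.Icc cmin 1)
    (ha : ∀ t, (a (t + 1)).card = K) (hK : 1 ≤ K) (hB : 0 ≤ B) {T : ℕ}
    (hT : B < T * (K * cmin)) (ρ : ℕ → Fin N → ℝ) (hρ : ∀ t i, ρ t i ∈ Set.Icc (0 : ℝ) 1) :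
    collected B a κ ρ T - gain B a ρ κ ∈ Set.Icc (0 : ℝ) K := by
  rw [collected_eq hcm hκ ha hK hB hT, gain_eq_sum_range]
  obtain ⟨n, hn⟩ := Nat.exists_eq_succ_of_ne_zero (stoppingTime_pos hcm hκ ha hK hB).ne'
  rw [hn, Nat.succ_eq_add_one, Nat.add_sub_cancel, Finset.sum_range_succ, add_sub_cancel_left]
  simpa using sum_mem_Icc (ha n) (hρ (n + 1))

/-- The stopping round is the one that crosses B, and it overshoots by at most its own cost, which
is at most K. -/
theorem collected_cost_mem (hcm : 0 < cmin) (hκ : ∀ t i, κ t i ∈ Set.Icc cmin 1)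
    (ha : ∀ t, (a (t + 1)).card = K) (hK : 1 ≤ K) (hB : 0 ≤ B) {T : ℕ}
    (hT : B < T * (K * cmin)) : collected B a κ κ T ∈ Set.Icc B (B + K) := by
  have hs : ∀ n, ∑ s ∈ Finset.range n, ∑ i ∈ a (s + 1), κ (s + 1) i = spent a κ n := by
    intro n
    induction n with
    | zero => simp [spent_zero]
    | succ n ih => rw [Finset.sum_range_succ, ih, spent_succ]
  rw [collected_eq hcm hκ ha hK hB hT, hs]
  have h := lt_stoppingTime_iff hcm hκ ha hK hB
  constructor
  · have := (not_congr (h (stoppingTime B a κ))).1 (lt_irrefl _)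
    linarith
  · obtain ⟨n, hn⟩ := Nat.exists_eq_succ_of_ne_zero (stoppingTime_pos hcm hκ ha hK hB).ne'
    have h1 := (h n).1 (by omega)
    rw [hn, Nat.succ_eq_add_one, spent_succ]
    linarith [(sum_mem_Icc (ha n) (hκ (n + 1))).2]

end Stopping

/-! ### Concentration for adaptively chosen draws -/

section Concentration

open scoped ENNReal

/-- `x t` takes values in `[0, 1]`, has mean `m`, is independent of the past `ℱ t`, and belongs to
the past `ℱ (t + 1)` of time `t + 1`. -/
structure IsIndepOfPast {Ω : Type*} [mΩ : MeasurableSpace Ω] (P : Measure Ω)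
    (ℱ : ℕ → MeasurableSpace Ω) (x : ℕ → Ω → ℝ) (m : ℝ) : Prop where
  le : ∀ t, ℱ t ≤ mΩ
  mono : Monotone ℱ
  adapted : ∀ t, Measurable[ℱ (t + 1)] (x t)
  indep : ∀ t, Indep (ℱ t) (MeasurableSpace.comap (x t) inferInstance) P
  mem : ∀ t, ∀ᵐ ω ∂P, x t ω ∈ Set.Icc (0 : ℝ) 1
  mean : ∀ t, ∫ ω, x t ω ∂P = m

variable {Ω : Type*} [mΩ : MeasurableSpace Ω] {P : Measure Ω}
  {ℱ : ℕ → MeasurableSpace Ω} {x : ℕ → Ω → ℝ} {m : ℝ}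

theorem IsIndepOfPast.measurable (h : IsIndepOfPast P ℱ x m) (t : ℕ) : Measurable (x t) :=
  (h.adapted t).mono (h.le _) le_rfl

/-- One term of Wald's identity: the decision to draw is independent of the value drawn. -/
theorem IsIndepOfPast.integral_indicator (h : IsIndepOfPast P ℱ x m) {t : ℕ} {A : Set Ω}
    (hA : MeasurableSet[ℱ t] A) : 
    ∫ ω, A.indicator (x t) ω ∂P = ∫ ω, A.indicator (fun _ => m) ω ∂P := by
  have h1 : Measurable[ℱ t] (A.indicator (fun _ => (1 : ℝ))) :=
    by
    exact Measurable.indicator measurable_const hA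
  have hind : IndepFun (A.indicator (fun _ => (1 : ℝ))) (x t) P := by
    rw [IndepFun_iff_Indep]
    exact indep_of_indep_of_le_left (h.indep t) h1.comap_le
  have h2 := hind.integral_fun_mul_eq_mul_integral
    (h1.mono (h.le t) le_rfl).aestronglyMeasurable (h.measurable t).aestronglyMeasurable
  have h3 : ∀ ω, A.indicator (x t) ω = A.indicator (fun _ => (1 : ℝ)) ω * x t ω := by
    intro ω
    by_cases hω : ω ∈ A <;> simp [hω]
  have h4 : ∀ ω, A.indicator (fun _ => m) ω = A.indicator (fun _ => (1 : ℝ)) ω * m := by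
    intro ω
    by_cases hω : ω ∈ A <;> simp [hω]
  simp_rw [h3, h4]
  rw [h2, integral_mul_const, h.mean]

variable [IsProbabilityMeasure P]

/-- Hoeffding's lemma: a variable with values in an interval of length 1 is sub-Gaussian with
variance proxy 1/4. -/
theorem IsIndepOfPast.lintegral_exp_le (h : IsIndepOfPast P ℱ x m) (l : ℝ) (t : ℕ) :
    ∫⁻ ω, ENNReal.ofReal (Real.exp (l * (x t ω - m) - l ^ 2 / 8)) ∂P ≤ 1 := by
  have hs := hasSubgaussianMGF_of_mem_Icc (h.measurable t).aemeasurable (h.mem t)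
  rw [h.mean] at hs
  have hi : Integrable (fun ω => Real.exp (l * (x t ω - m) - l ^ 2 / 8)) P := by
    simp_rw [Real.exp_sub]
    exact (hs.integrable_exp_mul l).div_const _
  rw [← ofReal_integral_eq_lintegral_ofReal hi (ae_of_all _ fun _ => (Real.exp_pos _).le)]
  refine ENNReal.ofReal_le_one.2 ?_
  simp_rw [Real.exp_sub]
  rw [integral_div, div_le_one (Real.exp_pos _)]
  refine (hs.mgf_le l).trans (Real.exp_le_exp.2 (le_of_eq ?_))
  simp
  ring

/-- The exponentials form a supermartingale: a skipped time leaves the product unchanged, and a draw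
multiplies it by an independent factor of mean at most 1. -/
theorem IsIndepOfPast.lintegral_exp_sum_le (h : IsIndepOfPast P ℱ x m) {q : ℕ → Set Ω}
    (hq : ∀ t, MeasurableSet[ℱ t] (q t)) (l : ℝ) (t : ℕ) :
    ∫⁻ ω, ENNReal.ofReal (Real.exp (∑ s ∈ Finset.range t,
      (q s).indicator (fun ω => l * (x s ω - m) - l ^ 2 / 8) ω)) ∂P ≤ 1 := by
  induction t with
  | zero => simp
  | succ t ih =>
    set W : Ω → ℝ≥0∞ := fun ω => ENNReal.ofReal (Real.exp (∑ s ∈ Finset.range t,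
      (q s).indicator (fun ω => l * (x s ω - m) - l ^ 2 / 8) ω)) with hW
    set Y : Ω → ℝ≥0∞ := fun ω => ENNReal.ofReal (Real.exp (l * (x t ω - m) - l ^ 2 / 8)) with hY
    have hWm : Measurable[ℱ t] W := by
      refine ENNReal.measurable_ofReal.comp (Real.measurable_exp.comp ?_)
      refine @Finset.measurable_fun_sum _ _ _ _ _ _ (ℱ t) _ _ fun s hs => ?_
      have hst : s < t := Finset.mem_range.1 hs
      refine Measurable.indicator ?_ (h.mono hst.le _ (hq s))
      have hx : Measurable[ℱ t] (x s) := (h.adapted s).mono (h.mono hst) le_rfl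
      exact ((hx.sub_const m).const_mul l).sub_const _
    have hYm : Measurable[MeasurableSpace.comap (x t) inferInstance] Y := by
      have hx : Measurable[MeasurableSpace.comap (x t) inferInstance] (x t) :=
        comap_measurable _
      exact ENNReal.measurable_ofReal.comp
        (Real.measurable_exp.comp (((hx.sub_const m).const_mul l).sub_const _))
    have hsplit : ∀ ω, ENNReal.ofReal (Real.exp (∑ s ∈ Finset.range (t + 1),
        (q s).indicator (fun ω => l * (x s ω - m) - l ^ 2 / 8) ω)) =
        (q t)ᶜ.indicator W ω + (q t).indicator W ω * Y ω := by
      intro ω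
      rw [Finset.sum_range_succ, Real.exp_add, ENNReal.ofReal_mul (Real.exp_pos _).le]
      by_cases hω : ω ∈ q t <;> simp [hω, hW, hY]
    have hqm : MeasurableSet (q t) := h.le t _ (hq t)
    have hWm' : Measurable W := hWm.mono (h.le t) le_rfl
    simp_rw [hsplit]
    rw [lintegral_add_left (hWm'.indicator hqm.compl),
      lintegral_mul_eq_lintegral_mul_lintegral_of_independent_measurableSpace (h.le t)
        (measurable_iff_comap_le.1 (h.measurable t)) (h.indep t) (hWm.indicator (hq t)) hYm]
    calc ∫⁻ ω, (q t)ᶜ.indicator W ω ∂P + (∫⁻ ω, (q t).indicator W ω ∂P) * ∫⁻ ω, Y ω ∂P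
        ≤ ∫⁻ ω, (q t)ᶜ.indicator W ω ∂P + (∫⁻ ω, (q t).indicator W ω ∂P) * 1 := by
          gcongr
          exact h.lintegral_exp_le l t
      _ = ∫⁻ ω, W ω ∂P := by
          rw [mul_one, lintegral_indicator hqm.compl, lintegral_indicator hqm, add_comm,
            lintegral_add_compl _ hqm]
      _ ≤ 1 := ih

/-- Number of times `s < t` with `ω ∈ q s`. -/
def drawCount {Ω : Type*} (q : ℕ → Set Ω) (t : ℕ) (ω : Ω) : ℝ :=
  ∑ s ∈ Finset.range t, (q s).indicator (fun _ => (1 : ℝ)) ω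

/-- Sum of the deviations from `m` of the `x s` with `s < t` and `ω ∈ q s`. -/
def drawDev {Ω : Type*} (x : ℕ → Ω → ℝ) (m : ℝ) (q : ℕ → Set Ω) (t : ℕ) (ω : Ω) : ℝ :=
  ∑ s ∈ Finset.range t, (q s).indicator (fun ω => x s ω - m) ω

theorem sum_indicator_eq {Ω : Type*} (x : ℕ → Ω → ℝ) (m : ℝ) (q : ℕ → Set Ω) (l : ℝ) (t : ℕ) (ω : Ω) :
    ∑ s ∈ Finset.range t, (q s).indicator (fun ω => l * (x s ω - m) - l ^ 2 / 8) ω =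
      l * drawDev x m q t ω - l ^ 2 / 8 * drawCount q t ω := by
  rw [drawDev, drawCount, Finset.mul_sum, Finset.mul_sum, ← Finset.sum_sub_distrib]
  refine Finset.sum_congr rfl fun s _ => ?_
  by_cases hω : ω ∈ q s <;> simp [hω]

theorem IsIndepOfPast.measure_exp_le (h : IsIndepOfPast P ℱ x m) {q : ℕ → Set Ω}
    (hq : ∀ t, MeasurableSet[ℱ t] (q t)) (l b : ℝ) (t : ℕ) :
    P {ω | b ≤ l * drawDev x m q t ω - l ^ 2 / 8 * drawCount q t ω} ≤
      ENNReal.ofReal (Real.exp (-b)) := by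
  have hm : Measurable fun ω => ENNReal.ofReal (Real.exp (∑ s ∈ Finset.range t,
      (q s).indicator (fun ω => l * (x s ω - m) - l ^ 2 / 8) ω)) := by
    refine ENNReal.measurable_ofReal.comp (Real.measurable_exp.comp ?_)
    refine Finset.measurable_fun_sum _ fun s _ => ?_
    exact Measurable.indicator ((((h.measurable s).sub_const m).const_mul l).sub_const _)
      (h.le s _ (hq s))
  have h1 := (mul_meas_ge_le_lintegral₀ hm.aemeasurable (ENNReal.ofReal (Real.exp b))).trans
    (h.lintegral_exp_sum_le hq l t)
  simp_rw [sum_indicator_eq, ENNReal.ofReal_le_ofReal_iff (Real.exp_pos _).le,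
    Real.exp_le_exp] at h1
  rw [Real.exp_neg, ENNReal.ofReal_inv_of_pos (Real.exp_pos b)]
  rw [mul_comm] at h1
  rw [← one_div]
  exact (ENNReal.le_div_iff_mul_le (Or.inl (by simp [Real.exp_pos])) (Or.inl (by simp))).2 h1

/-- The deviation after `n` draws exceeds `√(L n)` with probability at most `2 exp (-2 L)`. -/
theorem IsIndepOfPast.measure_dev_le (h : IsIndepOfPast P ℱ x m) {q : ℕ → Set Ω}
    (hq : ∀ t, MeasurableSet[ℱ t] (q t)) {L : ℝ} (hL : 0 ≤ L) {n : ℕ} (hn : 1 ≤ n) (t : ℕ) :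
    P {ω | drawCount q t ω = n ∧ √(L * n) < |drawDev x m q t ω|} ≤
      ENNReal.ofReal (2 * Real.exp (-(2 * L))) := by
  have hn0 : (0 : ℝ) < n := by exact_mod_cast hn
  set e := √(L / n) with he
  have he0 : 0 ≤ e := Real.sqrt_nonneg _
  have he2 : e ^ 2 * n = L := by
    rw [he, Real.sq_sqrt (by positivity)]
    field_simp
  have hsq : √(L * n) = e * n := by
    rw [Real.sqrt_eq_iff_mul_self_eq (by positivity) (by positivity)]
    rw [← he2]; ring
  -- The slope λ = 4e maximizes λ e n - λ² n / 8; the maximum is 2 e² n = 2L. The two signs give the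
  -- two tails.
  have hsub : {ω | drawCount q t ω = n ∧ √(L * n) < |drawDev x m q t ω|} ⊆
      {ω | 2 * L ≤ (4 * e) * drawDev x m q t ω - (4 * e) ^ 2 / 8 * drawCount q t ω} ∪
      {ω | 2 * L ≤ (-(4 * e)) * drawDev x m q t ω - (-(4 * e)) ^ 2 / 8 * drawCount q t ω} := by
    rintro ω ⟨h1, h2⟩
    rw [hsq] at h2
    rcases lt_abs.1 h2 with h3 | h3
    · left
      simp only [Set.mem_ofPred_eq, h1]
      have := mul_le_mul_of_nonneg_left h3.le he0
      nlinarith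
    · right
      simp only [Set.mem_ofPred_eq, h1]
      have := mul_le_mul_of_nonneg_left h3.le he0
      nlinarith
  refine (measure_mono hsub).trans ((measure_union_le _ _).trans ?_)
  refine (add_le_add (h.measure_exp_le hq _ _ t) (h.measure_exp_le hq _ _ t)).trans ?_
  rw [← ENNReal.ofReal_add (Real.exp_pos _).le (Real.exp_pos _).le, two_mul (Real.exp _)]

theorem drawCount_le {Ω : Type*} (q : ℕ → Set Ω) (t : ℕ) (ω : Ω) : ∃ n : ℕ, n ≤ t ∧ drawCount q t ω = n := by
  induction t with
  | zero => exact ⟨0, le_rfl, by simp [drawCount]⟩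
  | succ t ih =>
    obtain ⟨n, hn, h⟩ := ih
    rw [drawCount] at h
    by_cases hω : ω ∈ q t
    · exact ⟨n + 1, by omega, by simp [drawCount, Finset.sum_range_succ, h, hω]⟩
    · exact ⟨n, by omega, by simp [drawCount, Finset.sum_range_succ, h, hω]⟩

/-- Uniformly over the number of draws, the deviation exceeds `√((K + 1) log t · count)` with
probability at most `2 / t ^ 2`. -/
theorem IsIndepOfPast.measure_dev_log_le (h : IsIndepOfPast P ℱ x m) {q : ℕ → Set Ω}
    (hq : ∀ t, MeasurableSet[ℱ t] (q t)) {K : ℕ} (hK : 1 ≤ K) {t : ℕ} (ht : 1 ≤ t) :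
    P {ω | 1 ≤ drawCount q t ω ∧
      √(((K : ℝ) + 1) * Real.log t * drawCount q t ω) < |drawDev x m q t ω|} ≤
      ENNReal.ofReal (2 / (t : ℝ) ^ 2) := by
  have ht1 : (1 : ℝ) ≤ t := by exact_mod_cast ht
  have hK1 : (1 : ℝ) ≤ K := by exact_mod_cast hK
  have hlog := Real.log_nonneg ht1
  set L := ((K : ℝ) + 1) * Real.log t with hL
  have hL0 : 0 ≤ L := by positivity
  -- Since K ≥ 1, the exponent 2(K+1) is at least 4; the cube suffices, as the union over at most t
  -- values of the count costs one factor t.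
  have hexp : Real.exp (-(2 * L)) ≤ ((t : ℝ) ^ 3)⁻¹ := by
    rw [Real.exp_neg]
    refine inv_anti₀ (by positivity) ?_
    rw [← Real.exp_log (show (0 : ℝ) < (t : ℝ) ^ 3 by positivity), Real.log_pow]
    refine Real.exp_le_exp.2 ?_
    push_cast
    nlinarith
  have hsub : {ω | 1 ≤ drawCount q t ω ∧ √(L * drawCount q t ω) < |drawDev x m q t ω|} ⊆
      ⋃ n ∈ Finset.Icc 1 t, {ω | drawCount q t ω = n ∧ √(L * n) < |drawDev x m q t ω|} := by
    rintro ω ⟨h1, h2⟩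
    obtain ⟨n, hn, hc⟩ := drawCount_le q t ω
    rw [hc] at h1 h2
    simp only [Set.mem_iUnion, Finset.mem_Icc]
    exact ⟨n, ⟨by exact_mod_cast h1, hn⟩, hc, h2⟩
  refine (measure_mono hsub).trans ((measure_biUnion_finset_le _ _).trans ?_)
  refine (Finset.sum_le_card_nsmul _ _ (ENNReal.ofReal (2 * ((t : ℝ) ^ 3)⁻¹)) fun n hn => ?_).trans ?_
  · refine (h.measure_dev_le hq hL0 (Finset.mem_Icc.1 hn).1 t).trans
      (ENNReal.ofReal_le_ofReal ?_)
    linarith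
  · rw [Nat.card_Icc, Nat.add_sub_cancel, nsmul_eq_mul, ← ENNReal.ofReal_natCast,
      ← ENNReal.ofReal_mul (by positivity)]
    refine ENNReal.ofReal_le_ofReal (le_of_eq ?_)
    field_simp

end Concentration

/-! ### Confidence bounds for the ratios, and the gap -/

section Index

/-- The error is split over the sample denominator y, which is itself at least `cmin`. This gives
`cmin` in the denominator, where the exploration term has the smaller `cmin - ε`. -/
theorem abs_div_sub_div_le {x y p q ε cmin : ℝ} (hcm : 0 < cmin) (hy : cmin ≤ y) (hq : cmin ≤ q)
    (hp : p ∈ Set.Icc (0 : ℝ) 1) (hx : |x - p| ≤ ε) (hyq : |y - q| ≤ ε) :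
    |x / y - p / q| ≤ ε * (1 + 1 / cmin) / cmin := by
  have hy0 : 0 < y := hcm.trans_le hy
  have hq0 : 0 < q := hcm.trans_le hq
  have hε : 0 ≤ ε := (abs_nonneg _).trans hx
  have h1 : x / y - p / q = ((x - p) + p / q * (q - y)) / y := by
    field_simp
    ring
  have hpq : p / q ≤ 1 / cmin := div_le_div₀ zero_le_one hp.2 hcm hq
  have hpq0 : 0 ≤ p / q := div_nonneg hp.1 hq0.le
  rw [h1, abs_div, abs_of_pos hy0]
  have h2 : |(x - p) + p / q * (q - y)| ≤ ε * (1 + 1 / cmin) := by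
    refine (abs_add_le _ _).trans ?_
    rw [abs_mul, abs_of_nonneg hpq0, abs_sub_comm q y, mul_add, mul_one, mul_comm ε]
    exact add_le_add hx (mul_le_mul hpq hyq (abs_nonneg _) (by positivity))
  exact div_le_div₀ (by positivity) h2 hcm hy

/-- An arm whose confidence radius is below this threshold has an exploration term below
`Δ / 2`. -/
def radius (cmin Δ : ℝ) : ℝ := Δ * cmin / 2 / (1 + 1 / cmin + Δ / 2)

theorem radius_pos {cmin Δ : ℝ} (hcm : 0 < cmin) (hΔ : 0 < Δ) : 0 < radius cmin Δ := by
  unfold radius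
  positivity

theorem radius_lt {cmin Δ : ℝ} (hcm : 0 < cmin) (hΔ : 0 < Δ) : radius cmin Δ < cmin := by
  unfold radius
  rw [div_lt_iff₀ (by positivity)]
  have : 0 < cmin * (1 + 1 / cmin) := by positivity
  nlinarith

theorem explore_lt {cmin Δ ε : ℝ} (hcm : 0 < cmin) (hΔ : 0 < Δ) (hε : ε < radius cmin Δ) :
    ε * (1 + 1 / cmin) / (cmin - ε) < Δ / 2 := by
  have h := hε.trans (radius_lt hcm hΔ)
  rw [div_lt_iff₀ (by linarith)]
  unfold radius at hε
  rw [lt_div_iff₀ (by positivity)] at hε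
  linarith

/-- The confidence radius of an arm observed `n` times in round `t`. -/
def confRadius (K t n : ℕ) : ℝ := √(((K : ℝ) + 1) * Real.log t / n)

theorem le_confRadius_explore {cmin ε : ℝ} (hcm : 0 < cmin) (hε0 : 0 ≤ ε) (hε : ε < cmin) :
    ε * (1 + 1 / cmin) / cmin ≤ ε * (1 + 1 / cmin) / (cmin - ε) :=
  div_le_div_of_nonneg_left (by positivity) (by linarith) (by linarith)

variable {N K : ℕ} {cmin : ℝ} {S : Stats N} {i : Fin N} {p q : ℝ}

theorem ratio_le_ucbIndex (hcm : 0 < cmin) {t : ℕ}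
    (hy : cmin ≤ S.costSum i / S.count i) (hq : cmin ≤ q) (hp : p ∈ Set.Icc (0 : ℝ) 1)
    (hr : |S.rewardSum i / S.count i - p| ≤ confRadius K t (S.count i))
    (hc : |S.costSum i / S.count i - q| ≤ confRadius K t (S.count i)) :
    ((p / q : ℝ) : EReal) ≤ ucbIndex K cmin t S i := by
  have h := abs_div_sub_div_le hcm hy hq hp hr hc
  unfold ucbIndex exploration
  simp only
  split_ifs with hε
  · rw [← EReal.coe_add, EReal.coe_le_coe_iff]
    have := le_confRadius_explore hcm (Real.sqrt_nonneg _) hε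
    have h2 := (abs_le.1 h).1
    unfold confRadius at h2
    linarith
  · rw [EReal.coe_add_top]
    exact le_top

/-- Below the threshold radius the exploration term is less than Δ/2, and the estimation error is no
larger than that term. -/
theorem ucbIndex_lt (hcm : 0 < cmin) {t : ℕ} {Δ : ℝ} (hΔ : 0 < Δ)
    (hy : cmin ≤ S.costSum i / S.count i) (hq : cmin ≤ q) (hp : p ∈ Set.Icc (0 : ℝ) 1)
    (hr : |S.rewardSum i / S.count i - p| ≤ confRadius K t (S.count i))
    (hc : |S.costSum i / S.count i - q| ≤ confRadius K t (S.count i))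
    (hlt : confRadius K t (S.count i) < radius cmin Δ) :
    ucbIndex K cmin t S i < ((p / q + Δ : ℝ) : EReal) := by
  have h := abs_div_sub_div_le hcm hy hq hp hr hc
  have hε := hlt.trans (radius_lt hcm hΔ)
  have h3 := explore_lt hcm hΔ hlt
  have h4 := le_confRadius_explore hcm (Real.sqrt_nonneg _) hε
  unfold confRadius at *
  unfold ucbIndex exploration
  simp only
  rw [if_pos hε, ← EReal.coe_add, EReal.coe_lt_coe_iff]
  have h2 := (abs_le.1 h).2
  linarith

/-- Exchanging j for i in `astar` gives a competing set whose sum differs only by these two values.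
-/
theorem gapMin_le {μ : Fin N → ℝ} {astar : Finset (Fin N)} (hcard : astar.card = K) {i j : Fin N}
    (hi : i ∉ astar) (hj : j ∈ astar) : gapMin K μ astar ≤ μ j - μ i := by
  have hij : i ∉ astar.erase j := fun h => hi (Finset.mem_of_mem_erase h)
  have hmem : ∑ k ∈ insert i (astar.erase j), μ k ∈ {x : ℝ | ∃ a : Finset (Fin N),
      a.card = K ∧ a ≠ astar ∧ x = ∑ j ∈ a, μ j} := by
    refine ⟨_, ?_, ?_, rfl⟩
    · rw [Finset.card_insert_of_notMem hij, Finset.card_erase_add_one hj, hcard]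
    · exact fun h => hi (h ▸ Finset.mem_insert_self _ _)
  have hbdd : BddAbove {x : ℝ | ∃ a : Finset (Fin N),
      a.card = K ∧ a ≠ astar ∧ x = ∑ j ∈ a, μ j} := by
    refine (Set.Finite.subset (Set.finite_range fun a : Finset (Fin N) => ∑ j ∈ a, μ j) ?_).bddAbove
    rintro x ⟨a, -, -, rfl⟩
    exact ⟨a, rfl⟩
  have h1 := le_csSup hbdd hmem
  rw [Finset.sum_insert hij] at h1
  have h2 := Finset.add_sum_erase astar μ hj
  unfold gapMin
  linarith

theorem exists_mem_notMem_of_card_eq {a b : Finset (Fin N)} (h : a.card = b.card) (hne : a ≠ b) :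
    ∃ i ∈ a, i ∉ b := by
  by_contra! hc
  exact hne (Finset.eq_of_subset_of_card_le hc h.ge)

end Index

/-! ### Counting suboptimal rounds along one path -/

section Path

variable {N K : ℕ} {cmin : ℝ} {sel : ℕ → (Fin N → EReal) → Finset (Fin N)}
  {ρ κ : ℕ → Fin N → ℝ}

theorem ucbPlay_succ_card (hsel : IsTopKRule K sel) (t : ℕ) :
    (ucbPlay K cmin sel ρ κ (t + 1)).card = K :=
  (hsel.isTopK _ _).1

theorem ucbStats_count_succ (t : ℕ) (i : Fin N) :
    (ucbStats K cmin sel ρ κ (t + 1)).count i =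
      if i ∈ ucbPlay K cmin sel ρ κ (t + 1) then (ucbStats K cmin sel ρ κ t).count i + 1
      else (ucbStats K cmin sel ρ κ t).count i := rfl

theorem ucbStats_count (t : ℕ) (i : Fin N) :
    ((ucbStats K cmin sel ρ κ t).count i : ℝ) =
      ∑ s ∈ Finset.range (t + 1), if i ∈ ucbPlay K cmin sel ρ κ s then 1 else 0 := by
  induction t with
  | zero => simp [ucbStats, Stats.init, ucbPlay]
  | succ t ih =>
    rw [Finset.sum_range_succ, ← ih, ucbStats_count_succ]
    split_ifs <;> simp

theorem ucbStats_rewardSum (t : ℕ) (i : Fin N) :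
    (ucbStats K cmin sel ρ κ t).rewardSum i =
      ∑ s ∈ Finset.range (t + 1), if i ∈ ucbPlay K cmin sel ρ κ s then ρ s i else 0 := by
  induction t with
  | zero => simp [ucbStats, Stats.init, ucbPlay]
  | succ t ih =>
    rw [Finset.sum_range_succ, ← ih]
    change (if i ∈ ucbPlay K cmin sel ρ κ (t + 1) then _ else _) = _
    split_ifs <;> simp

theorem ucbStats_costSum (t : ℕ) (i : Fin N) :
    (ucbStats K cmin sel ρ κ t).costSum i =
      ∑ s ∈ Finset.range (t + 1), if i ∈ ucbPlay K cmin sel ρ κ s then κ s i else 0 := by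
  induction t with
  | zero => simp [ucbStats, Stats.init, ucbPlay]
  | succ t ih =>
    rw [Finset.sum_range_succ, ← ih]
    change (if i ∈ ucbPlay K cmin sel ρ κ (t + 1) then _ else _) = _
    split_ifs <;> simp

theorem one_le_ucbStats_count (t : ℕ) (i : Fin N) :
    1 ≤ (ucbStats K cmin sel ρ κ t).count i := by
  induction t with
  | zero => simp [ucbStats, Stats.init]
  | succ t ih =>
    rw [ucbStats_count_succ]
    split_ifs <;> omega

theorem le_ucbStats_meanCost (hκ : ∀ t i, κ t i ∈ Set.Icc cmin 1) (t : ℕ) (i : Fin N) :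
    cmin ≤ (ucbStats K cmin sel ρ κ t).costSum i / (ucbStats K cmin sel ρ κ t).count i := by
  have h1 : (0 : ℝ) < (ucbStats K cmin sel ρ κ t).count i := by
    exact_mod_cast one_le_ucbStats_count t i
  rw [le_div_iff₀ h1, ucbStats_costSum, ucbStats_count, Finset.mul_sum]
  refine Finset.sum_le_sum fun s _ => ?_
  split_ifs
  · simpa using (hκ s i).1
  · simp

/-- In round `t + 1` a sample mean of an arm deviates from its mean by more than the
confidence radius; `n` is the number of observations, `σ` their sum,
`m` the mean of the arm. -/
def deviates (K t : ℕ) (n : ℕ) (σ m : ℝ) : Prop :=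
  √(((K : ℝ) + 1) * Real.log ((t + 1 : ℕ) : ℝ) * n) < |σ - n * m|

theorem abs_le_confRadius {t n : ℕ} {σ m : ℝ} (hn : 1 ≤ n) (h : ¬ deviates K t n σ m) :
    |σ / n - m| ≤ confRadius K (t + 1) n := by
  have hn0 : (0 : ℝ) < n := by exact_mod_cast hn
  unfold deviates at h
  rw [not_lt] at h
  have h1 : σ / n - m = (σ - n * m) / n := by
    field_simp
  rw [h1, abs_div, abs_of_pos hn0, div_le_iff₀ hn0]
  refine h.trans (le_of_eq ?_)
  unfold confRadius
  have h2 : (n : ℝ) = √((n : ℝ) ^ 2) := (Real.sqrt_sq hn0.le).symm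
  conv_rhs => rw [h2]
  rw [← Real.sqrt_mul' _ (by positivity)]
  congr 1
  rw [Real.sqrt_sq hn0.le]
  field_simp

/-- If no sample mean deviates and a suboptimal set is played, an arm with few observations
is played. -/
theorem exists_count_le (hcm : 0 < cmin) {μr μc : Fin N → ℝ} (hμr : ∀ i, μr i ∈ Set.Icc (0 : ℝ) 1)
    (hμc : ∀ i, cmin ≤ μc i) {astar : Finset (Fin N)} (hcard : astar.card = K)
    (hgap : 0 < gapMin K (ratio μr μc) astar) (hsel : IsTopKRule K sel)
    (hκ : ∀ t i, κ t i ∈ Set.Icc cmin 1) {t T : ℕ} (htT : t < T)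
    (hr : ∀ i, ¬ deviates K t ((ucbStats K cmin sel ρ κ t).count i)
      ((ucbStats K cmin sel ρ κ t).rewardSum i) (μr i))
    (hc : ∀ i, ¬ deviates K t ((ucbStats K cmin sel ρ κ t).count i)
      ((ucbStats K cmin sel ρ κ t).costSum i) (μc i))
    (hne : ucbPlay K cmin sel ρ κ (t + 1) ≠ astar) :
    ∃ i ∈ ucbPlay K cmin sel ρ κ (t + 1), ((ucbStats K cmin sel ρ κ t).count i : ℝ) ≤
      ((K : ℝ) + 1) * Real.log T / radius cmin (gapMin K (ratio μr μc) astar) ^ 2 := by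
  set Δ := gapMin K (ratio μr μc) astar with hΔ
  set S := ucbStats K cmin sel ρ κ t with hS
  have hcardp : (ucbPlay K cmin sel ρ κ (t + 1)).card = K := ucbPlay_succ_card hsel t
  obtain ⟨i, hi, hi'⟩ := exists_mem_notMem_of_card_eq (hcardp.trans hcard.symm) hne
  obtain ⟨j, hj, hj'⟩ := exists_mem_notMem_of_card_eq (hcard.trans hcardp.symm) hne.symm
  have hU : ucbIndex K cmin (t + 1) S j ≤ ucbIndex K cmin (t + 1) S i :=
    (hsel.isTopK (t + 1) (ucbIndex K cmin (t + 1) S)).2 i hi j hj'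
  have hn : ∀ k, 1 ≤ S.count k := fun k => one_le_ucbStats_count t k
  refine ⟨i, hi, ?_⟩
  -- Otherwise μ^j ≤ U_j ≤ U_i < μ^i + Δ, which contradicts the gap between j and i.
  have hrad : radius cmin Δ ≤ confRadius K (t + 1) (S.count i) := by
    by_contra! hlt
    have h1 := ratio_le_ucbIndex hcm (le_ucbStats_meanCost hκ t j) (hμc j) (hμr j)
      (abs_le_confRadius (hn j) (hr j)) (abs_le_confRadius (hn j) (hc j))
    have h2 := ucbIndex_lt hcm hgap (le_ucbStats_meanCost hκ t i) (hμc i) (hμr i)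
      (abs_le_confRadius (hn i) (hr i)) (abs_le_confRadius (hn i) (hc i)) hlt
    have h3 := EReal.coe_lt_coe_iff.1 ((h1.trans hU).trans_lt h2)
    have h4 : Δ ≤ ratio μr μc j - ratio μr μc i := gapMin_le hcard hi' hj
    unfold ratio at h4
    linarith
  have hrad0 := radius_pos hcm hgap
  have hn0 : (0 : ℝ) < S.count i := by exact_mod_cast hn i
  have hlog0 : 0 ≤ Real.log ((t + 1 : ℕ) : ℝ) := Real.log_natCast_nonneg _
  have hsq := (Real.le_sqrt hrad0.le (by positivity)).1 hrad
  rw [le_div_iff₀ hn0] at hsq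
  rw [le_div_iff₀ (by positivity), mul_comm]
  refine hsq.trans ?_
  gcongr
  omega

/-- Every round counted here adds one observation of arm i, and the count starts at 1 because of
time 0. -/
theorem sum_few_observations_le {l : ℝ} (hl : 0 ≤ l) (i : Fin N) (T : ℕ) :
    (∑ s ∈ Finset.range T, if i ∈ ucbPlay K cmin sel ρ κ (s + 1) ∧
      ((ucbStats K cmin sel ρ κ s).count i : ℝ) ≤ l then (1 : ℝ) else 0) ≤ l := by
  -- The first bound, by the count minus 1, carries the induction: when a round is counted, the
  -- count before it is at most l, so the increased sum is too.
  suffices h : (∑ s ∈ Finset.range T, if i ∈ ucbPlay K cmin sel ρ κ (s + 1) ∧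
      ((ucbStats K cmin sel ρ κ s).count i : ℝ) ≤ l then (1 : ℝ) else 0) ≤
      ((ucbStats K cmin sel ρ κ T).count i : ℝ) - 1 ∧
      (∑ s ∈ Finset.range T, if i ∈ ucbPlay K cmin sel ρ κ (s + 1) ∧
      ((ucbStats K cmin sel ρ κ s).count i : ℝ) ≤ l then (1 : ℝ) else 0) ≤ l from h.2
  induction T with
  | zero => simp [ucbStats, Stats.init, hl]
  | succ T ih =>
    rw [Finset.sum_range_succ, ucbStats_count_succ]
    by_cases h1 : i ∈ ucbPlay K cmin sel ρ κ (T + 1)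
    · by_cases h2 : ((ucbStats K cmin sel ρ κ T).count i : ℝ) ≤ l
      · simp only [h1, h2, and_self, if_true]
        push_cast
        constructor <;> linarith
      · simp only [h1, h2, and_false, if_true, if_false]
        push_cast
        constructor <;> linarith
    · simpa [h1] using ih

open Classical in
/-- The number of suboptimal rounds is at most `N l` plus the number of rounds with a
deviating sample mean. -/
theorem sum_suboptimal_le (hcm : 0 < cmin) {μr μc : Fin N → ℝ}
    (hμr : ∀ i, μr i ∈ Set.Icc (0 : ℝ) 1)
    (hμc : ∀ i, cmin ≤ μc i) {astar : Finset (Fin N)} (hcard : astar.card = K)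
    (hgap : 0 < gapMin K (ratio μr μc) astar) (hsel : IsTopKRule K sel)
    (hκ : ∀ t i, κ t i ∈ Set.Icc cmin 1) (T : ℕ) :
    (∑ t ∈ Finset.range T, if ucbPlay K cmin sel ρ κ (t + 1) ≠ astar then (1 : ℝ) else 0) ≤
      N * (((K : ℝ) + 1) * Real.log T / radius cmin (gapMin K (ratio μr μc) astar) ^ 2) +
      ∑ t ∈ Finset.range T, ∑ i,
        ((if deviates K t ((ucbStats K cmin sel ρ κ t).count i)
          ((ucbStats K cmin sel ρ κ t).rewardSum i) (μr i) then (1 : ℝ) else 0) +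
        (if deviates K t ((ucbStats K cmin sel ρ κ t).count i)
          ((ucbStats K cmin sel ρ κ t).costSum i) (μc i) then (1 : ℝ) else 0)) := by
  set l := ((K : ℝ) + 1) * Real.log T / radius cmin (gapMin K (ratio μr μc) astar) ^ 2 with hl
  have hl0 : 0 ≤ l := by
    have := Real.log_natCast_nonneg T
    positivity
  have hN : (∑ i : Fin N, ∑ s ∈ Finset.range T, if i ∈ ucbPlay K cmin sel ρ κ (s + 1) ∧
      ((ucbStats K cmin sel ρ κ s).count i : ℝ) ≤ l then (1 : ℝ) else 0) ≤ N * l := by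
    refine (Finset.sum_le_card_nsmul _ _ l fun i _ => sum_few_observations_le hl0 i T).trans ?_
    simp
  refine le_trans ?_ (add_le_add hN le_rfl)
  -- With the sums exchanged it suffices to compare round by round: a suboptimal round has a
  -- deviating mean or plays an arm with at most l observations.
  rw [Finset.sum_comm, ← Finset.sum_add_distrib]
  refine Finset.sum_le_sum fun t ht => ?_
  have hnn : ∀ p : Prop, 0 ≤ if p then (1 : ℝ) else 0 := fun p => by split_ifs <;> simp
  have h1 : 0 ≤ ∑ i : Fin N, if i ∈ ucbPlay K cmin sel ρ κ (t + 1) ∧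
      ((ucbStats K cmin sel ρ κ t).count i : ℝ) ≤ l then (1 : ℝ) else 0 :=
    Finset.sum_nonneg fun i _ => by split_ifs <;> norm_num
  have h2 : ∀ i : Fin N, 0 ≤ ((if deviates K t ((ucbStats K cmin sel ρ κ t).count i)
          ((ucbStats K cmin sel ρ κ t).rewardSum i) (μr i) then (1 : ℝ) else 0) +
        (if deviates K t ((ucbStats K cmin sel ρ κ t).count i)
          ((ucbStats K cmin sel ρ κ t).costSum i) (μc i) then (1 : ℝ) else 0)) :=
    fun i => add_nonneg (hnn _) (hnn _)
  have h3 := Finset.sum_nonneg fun i (_ : i ∈ Finset.univ) => h2 i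
  by_cases hne : ucbPlay K cmin sel ρ κ (t + 1) = astar
  · rw [if_neg (not_not.2 hne)]
    exact add_nonneg h1 h3
  rw [if_pos hne]
  by_cases hdev : ∃ i, deviates K t ((ucbStats K cmin sel ρ κ t).count i)
      ((ucbStats K cmin sel ρ κ t).rewardSum i) (μr i) ∨
      deviates K t ((ucbStats K cmin sel ρ κ t).count i)
      ((ucbStats K cmin sel ρ κ t).costSum i) (μc i)
  · obtain ⟨i, hi⟩ := hdev
    refine le_add_of_nonneg_of_le h1 ?_
    refine le_trans ?_ (Finset.single_le_sum (fun i _ => h2 i) (Finset.mem_univ i))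
    rcases hi with hi | hi
    · rw [if_pos hi]
      exact le_add_of_nonneg_right (hnn _)
    · rw [if_pos hi]
      exact le_add_of_nonneg_left (hnn _)
  · push Not at hdev
    obtain ⟨i, hi, hil⟩ := exists_count_le hcm hμr hμc hcard hgap hsel hκ
      (Finset.mem_range.1 ht) (fun i => (hdev i).1) (fun i => (hdev i).2) hne
    refine le_add_of_le_of_nonneg ?_ h3
    refine le_trans ?_ (Finset.single_le_sum (fun i _ => by split_ifs <;> norm_num)
      (Finset.mem_univ i))
    rw [if_pos ⟨hi, hil⟩]

end Path

/-! ### Measurability of the algorithm -/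

section Measurability

variable {Ω : Type*} [MeasurableSpace Ω] {N K : ℕ} {cmin : ℝ}
  {sel : ℕ → (Fin N → EReal) → Finset (Fin N)} {r c : ℕ → Fin N → Ω → ℝ}
  {a : Ω → ℕ → Finset (Fin N)}

theorem measurable_sum_mem {w : Fin N → Ω → ℝ} (hw : ∀ i, Measurable (w i))
    {b : Ω → Finset (Fin N)} (hb : ∀ i, MeasurableSet {ω | i ∈ b ω}) :
    Measurable fun ω => ∑ i ∈ b ω, w i ω := by
  have h : ∀ ω, ∑ i ∈ b ω, w i ω = ∑ i, if i ∈ b ω then w i ω else 0 := fun ω => by simp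
  simp_rw [h]
  exact Finset.measurable_fun_sum _ fun i _ => Measurable.ite (hb i) (hw i) measurable_const

theorem measurable_spent {t : ℕ} (hc : ∀ s ≤ t, ∀ i, Measurable (c s i))
    (ha : ∀ s ≤ t, ∀ i, MeasurableSet {ω | i ∈ a ω s}) :
    Measurable fun ω => spent (a ω) (fun t i => c t i ω) t := by
  unfold spent
  refine Finset.measurable_fun_sum _ fun s hs => ?_
  have hst := (Finset.mem_Icc.1 hs).2
  exact measurable_sum_mem (hc s hst) (ha s hst)

/-- The statistics of UCB-MB after round `t` along the path `ω`. -/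
abbrev statsAt (K : ℕ) (cmin : ℝ) (sel : ℕ → (Fin N → EReal) → Finset (Fin N))
    (r c : ℕ → Fin N → Ω → ℝ) (t : ℕ) (ω : Ω) : Stats N :=
  ucbStats K cmin sel (fun t i => r t i ω) (fun t i => c t i ω) t

/-- The set played by UCB-MB in round `t` along the path `ω`. -/
abbrev playAt (K : ℕ) (cmin : ℝ) (sel : ℕ → (Fin N → EReal) → Finset (Fin N))
    (r c : ℕ → Fin N → Ω → ℝ) (ω : Ω) (t : ℕ) : Finset (Fin N) :=
  ucbPlay K cmin sel (fun t i => r t i ω) (fun t i => c t i ω) t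

theorem measurableSet_playAt_succ_eq (hsel : IsTopKRule K sel) {t : ℕ}
    (h : ∀ i, Measurable (fun ω => (statsAt K cmin sel r c t ω).count i) ∧
      Measurable (fun ω => (statsAt K cmin sel r c t ω).rewardSum i) ∧
      Measurable (fun ω => (statsAt K cmin sel r c t ω).costSum i)) (b : Finset (Fin N)) :
    MeasurableSet {ω | playAt K cmin sel r c ω (t + 1) = b} := by
  have hidx : Measurable fun ω => ucbIndex K cmin (t + 1) (statsAt K cmin sel r c t ω) := by
    refine measurable_pi_iff.2 fun i => ?_
    obtain ⟨h1, h2, h3⟩ := h i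
    have hn : Measurable fun ω => ((statsAt K cmin sel r c t ω).count i : ℝ) :=
      measurable_from_top.comp h1
    have he : Measurable fun ω => exploration K cmin (t + 1) ((statsAt K cmin sel r c t ω).count i) :=
      (measurable_from_top (f := fun n => exploration K cmin (t + 1) n)).comp h1
    exact ((h2.div hn).div (h3.div hn)).coe_real_ereal.add he
  exact hidx (hsel.measurable (t + 1) b)

theorem measurableSet_mem_playAt_succ (hsel : IsTopKRule K sel) {t : ℕ}
    (h : ∀ i, Measurable (fun ω => (statsAt K cmin sel r c t ω).count i) ∧
      Measurable (fun ω => (statsAt K cmin sel r c t ω).rewardSum i) ∧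
      Measurable (fun ω => (statsAt K cmin sel r c t ω).costSum i)) (i : Fin N) :
    MeasurableSet {ω | i ∈ playAt K cmin sel r c ω (t + 1)} := by
  have : {ω | i ∈ playAt K cmin sel r c ω (t + 1)} =
      ⋃ b ∈ {b : Finset (Fin N) | i ∈ b}, {ω | playAt K cmin sel r c ω (t + 1) = b} := by
    ext ω
    simp
  rw [this]
  exact MeasurableSet.biUnion (Set.to_countable _) fun b _ =>
    measurableSet_playAt_succ_eq hsel h b

theorem measurable_statsAt (hsel : IsTopKRule K sel) {t : ℕ}
    (hr : ∀ s ≤ t, ∀ i, Measurable (r s i)) (hc : ∀ s ≤ t, ∀ i, Measurable (c s i)) (i : Fin N) :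
    Measurable (fun ω => (statsAt K cmin sel r c t ω).count i) ∧
      Measurable (fun ω => (statsAt K cmin sel r c t ω).rewardSum i) ∧
      Measurable (fun ω => (statsAt K cmin sel r c t ω).costSum i) := by
  induction t generalizing i with
  | zero => exact ⟨measurable_const, hr 0 le_rfl i, hc 0 le_rfl i⟩
  | succ t ih =>
    have ih' := fun i => ih (fun s hs => hr s (hs.trans t.le_succ))
      (fun s hs => hc s (hs.trans t.le_succ)) i
    obtain ⟨h1, h2, h3⟩ := ih' i
    have hm := measurableSet_mem_playAt_succ hsel ih' i
    exact ⟨Measurable.ite hm (measurable_from_top.comp h1 : Measurable fun ω => _ + 1) h1,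
      Measurable.ite hm (h2.add (hr _ le_rfl i)) h2, Measurable.ite hm (h3.add (hc _ le_rfl i)) h3⟩

/-- Only outcomes at times s < t are assumed measurable, so that the lemma also applies with the
σ-algebra of the past and yields predictability of the play. -/
theorem measurableSet_mem_playAt (hsel : IsTopKRule K sel) {t : ℕ}
    (hr : ∀ s < t, ∀ i, Measurable (r s i)) (hc : ∀ s < t, ∀ i, Measurable (c s i)) (i : Fin N) :
    MeasurableSet {ω | i ∈ playAt K cmin sel r c ω t} := by
  cases t with
  | zero => simp [playAt, ucbPlay]
  | succ t =>
    exact measurableSet_mem_playAt_succ hsel (measurable_statsAt hsel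
      (fun s hs => hr s (Nat.lt_succ_of_le hs)) (fun s hs => hc s (Nat.lt_succ_of_le hs))) i

end Measurability

/-! ### The filtration of past outcomes and Wald's identity -/

section Past

variable {Ω : Type*} {N K : ℕ} {cmin : ℝ} {μr μc : Fin N → ℝ} {r c : ℕ → Fin N → Ω → ℝ}

/-- The rewards and costs of all arms at time `t`. -/
def outcome (r c : ℕ → Fin N → Ω → ℝ) (t : ℕ) (ω : Ω) (i : Fin N) : ℝ × ℝ := (r t i ω, c t i ω)

/-- The information generated by all outcomes before time `t`. -/
@[reducible] def past (r c : ℕ → Fin N → Ω → ℝ) (t : ℕ) : MeasurableSpace Ω :=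
  ⨆ s ∈ Set.Iio t, MeasurableSpace.comap (outcome r c s) inferInstance

theorem past_mono : Monotone (past r c) := fun _ _ h =>
  biSup_mono fun _ hs => lt_of_lt_of_le hs h

theorem measurable_outcome_comap_reward (t : ℕ) (i : Fin N) :
    Measurable[MeasurableSpace.comap (outcome r c t) inferInstance] (r t i) :=
  (measurable_fst.comp (measurable_pi_apply (X := fun _ : Fin N => ℝ × ℝ) i)).comp
    (comap_measurable (outcome r c t))

theorem measurable_outcome_comap_cost (t : ℕ) (i : Fin N) :
    Measurable[MeasurableSpace.comap (outcome r c t) inferInstance] (c t i) :=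
  (measurable_snd.comp (measurable_pi_apply (X := fun _ : Fin N => ℝ × ℝ) i)).comp
    (comap_measurable (outcome r c t))

theorem comap_outcome_le_past {s t : ℕ} (h : s < t) :
    MeasurableSpace.comap (outcome r c s) inferInstance ≤ past r c t :=
  le_biSup (fun s => MeasurableSpace.comap (outcome r c s) inferInstance) (Set.mem_Iio.2 h)

theorem measurable_past_reward {s t : ℕ} (h : s < t) (i : Fin N) :
    Measurable[past r c t] (r s i) :=
  (measurable_outcome_comap_reward s i).mono (comap_outcome_le_past h) le_rfl

theorem measurable_past_cost {s t : ℕ} (h : s < t) (i : Fin N) :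
    Measurable[past r c t] (c s i) :=
  (measurable_outcome_comap_cost s i).mono (comap_outcome_le_past h) le_rfl

variable {a : Ω → ℕ → Finset (Fin N)} {B : ℝ}

theorem ite_sum_eq_sum_indicator (p : Ω → Prop) [DecidablePred p] (b : Ω → Finset (Fin N))
    (w : Fin N → Ω → ℝ) (ω : Ω) :
    (if p ω then ∑ i ∈ b ω, w i ω else 0) =
      ∑ i, {ω | p ω ∧ i ∈ b ω}.indicator (w i) ω := by
  simp only [Set.indicator_apply, Set.mem_ofPred_eq]
  by_cases hp : p ω <;> simp [hp]

theorem collected_eq_sum_indicator (w : ℕ → Fin N → Ω → ℝ) (T : ℕ) (ω : Ω) :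
    collected B (a ω) (fun t i => c t i ω) (fun t i => w t i ω) T =
      ∑ s ∈ Finset.range T, ∑ i,
        {ω | spent (a ω) (fun t i => c t i ω) s ≤ B ∧ i ∈ a ω (s + 1)}.indicator
          (w (s + 1) i) ω :=
  Finset.sum_congr rfl fun s _ => ite_sum_eq_sum_indicator
    (fun ω => spent (a ω) (fun t i => c t i ω) s ≤ B) (fun ω => a ω (s + 1)) (w (s + 1)) ω

theorem measurableSet_spent_le_and_mem {m : MeasurableSpace Ω} {s : ℕ}
    (hc : ∀ u ≤ s, ∀ i, Measurable (c u i)) (ha : ∀ u ≤ s + 1, ∀ i, MeasurableSet {ω | i ∈ a ω u})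
    (i : Fin N) :
    MeasurableSet {ω | spent (a ω) (fun t i => c t i ω) s ≤ B ∧ i ∈ a ω (s + 1)} :=
  (measurableSet_le (measurable_spent hc fun u hu => ha u (hu.trans s.le_succ))
    measurable_const).inter (ha (s + 1) le_rfl i)

variable [mΩ : MeasurableSpace Ω] {P : Measure Ω}

theorem IsStochasticBandit.comap_outcome_le (h : IsStochasticBandit P cmin μr μc r c) (t : ℕ) :
    MeasurableSpace.comap (outcome r c t) inferInstance ≤ mΩ :=
  measurable_iff_comap_le.1 (measurable_pi_iff.2 fun i =>
    (h.measurable_reward t i).prodMk (h.measurable_cost t i))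

theorem IsStochasticBandit.past_le (h : IsStochasticBandit P cmin μr μc r c) (t : ℕ) :
    past r c t ≤ mΩ :=
  iSup₂_le fun s _ => h.comap_outcome_le s

/-- The two σ-algebras come from disjoint sets of times in an independent family. -/
theorem IsStochasticBandit.indep_past (h : IsStochasticBandit P cmin μr μc r c) (t : ℕ) :
    Indep (past r c t) (MeasurableSpace.comap (outcome r c t) inferInstance) P := by
  have h1 := indep_iSup_of_disjoint h.comap_outcome_le (iIndepFun.iIndep h.indep)
    (S := Set.Iio t) (T := {t}) (by simp)
  simpa [past] using h1

theorem IsStochasticBandit.isIndepOfPast_reward (h : IsStochasticBandit P cmin μr μc r c)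
    (i : Fin N) : IsIndepOfPast P (past r c) (fun t => r t i) (μr i) where
  le := h.past_le
  mono := past_mono
  adapted t := measurable_past_reward t.lt_succ_self i
  indep t := indep_of_indep_of_le_right (h.indep_past t)
    (measurable_iff_comap_le.1 (measurable_outcome_comap_reward t i))
  mem t := h.reward_mem t i
  mean t := by
    rw [← h.mean_reward i]
    exact ((h.ident t).comp (measurable_fst.comp (measurable_pi_apply i))).integral_eq

theorem IsStochasticBandit.isIndepOfPast_cost (h : IsStochasticBandit P cmin μr μc r c)
    (i : Fin N) : IsIndepOfPast P (past r c) (fun t => c t i) (μc i) where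
  le := h.past_le
  mono := past_mono
  adapted t := measurable_past_cost t.lt_succ_self i
  indep t := indep_of_indep_of_le_right (h.indep_past t)
    (measurable_iff_comap_le.1 (measurable_outcome_comap_cost t i))
  mem t := (h.cost_mem t i).mono fun _ hω => ⟨h.cmin_pos.le.trans hω.1, hω.2⟩
  mean t := by
    rw [← h.mean_cost i]
    exact ((h.ident t).comp (measurable_snd.comp (measurable_pi_apply i))).integral_eq

theorem IsIndepOfPast.integrable [IsProbabilityMeasure P] {ℱ : ℕ → MeasurableSpace Ω}
    {x : ℕ → Ω → ℝ} {m : ℝ} (h : IsIndepOfPast P ℱ x m) (t : ℕ) : Integrable (x t) P :=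
  Integrable.of_mem_Icc 0 1 (h.measurable t).aemeasurable (h.mem t)

theorem IsStochasticBandit.mean_reward_mem [IsProbabilityMeasure P]
    (h : IsStochasticBandit P cmin μr μc r c) (i : Fin N) : μr i ∈ Set.Icc (0 : ℝ) 1 := by
  refine ⟨(h.mean_reward_pos i).le, ?_⟩
  rw [← h.mean_reward i]
  refine (integral_mono_ae ((h.isIndepOfPast_reward i).integrable 0) (integrable_const (1 : ℝ))
    ((h.reward_mem 0 i).mono fun _ hω => hω.2)).trans ?_
  simp

theorem IsStochasticBandit.mean_cost_mem [IsProbabilityMeasure P]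
    (h : IsStochasticBandit P cmin μr μc r c) (i : Fin N) : μc i ∈ Set.Icc cmin 1 := by
  have hi := (h.isIndepOfPast_cost i).integrable 0
  rw [← h.mean_cost i]
  constructor
  · refine le_trans ?_ (integral_mono_ae (integrable_const cmin) hi
      ((h.cost_mem 0 i).mono fun _ hω => hω.1))
    simp
  · refine (integral_mono_ae hi (integrable_const (1 : ℝ))
      ((h.cost_mem 0 i).mono fun _ hω => hω.2)).trans ?_
    simp

theorem IsStochasticBandit.ae_mem (h : IsStochasticBandit P cmin μr μc r c) :
    ∀ᵐ ω ∂P, (∀ t i, r t i ω ∈ Set.Icc (0 : ℝ) 1) ∧ ∀ t i, c t i ω ∈ Set.Icc cmin 1 := by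
  have h1 := ae_all_iff.2 fun t => ae_all_iff.2 fun i => h.reward_mem t i
  have h2 := ae_all_iff.2 fun t => ae_all_iff.2 fun i => h.cost_mem t i
  filter_upwards [h1, h2] with ω ha hb using ⟨ha, hb⟩

theorem IsStochasticBandit.integrable_collected (h : IsStochasticBandit P cmin μr μc r c)
    (ha : ∀ t i, MeasurableSet {ω | i ∈ a ω t}) {w : ℕ → Fin N → Ω → ℝ}
    (hw : ∀ t i, Integrable (w t i) P) (T : ℕ) :
    Integrable (fun ω => collected B (a ω) (fun t i => c t i ω) (fun t i => w t i ω) T) P := by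
  simp_rw [collected_eq_sum_indicator w T]
  refine integrable_finsetSum _ fun s _ => ?_
  exact integrable_finsetSum _ fun i _ => (hw _ i).indicator
    (measurableSet_spent_le_and_mem (fun u _ => h.measurable_cost u) (fun u _ => ha u) i)

/-- Wald's identity. -/
theorem IsStochasticBandit.integral_collected [IsProbabilityMeasure P]
    (h : IsStochasticBandit P cmin μr μc r c)
    (ha : ∀ t i, MeasurableSet[past r c t] {ω | i ∈ a ω t}) {w : ℕ → Fin N → Ω → ℝ}
    {μ : Fin N → ℝ} (hw : ∀ i, IsIndepOfPast P (past r c) (fun t => w t i) (μ i)) (T : ℕ) :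
    ∫ ω, collected B (a ω) (fun t i => c t i ω) (fun t i => w t i ω) T ∂P =
      ∫ ω, collected B (a ω) (fun t i => c t i ω) (fun _ i => μ i) T ∂P := by
  simp_rw [collected_eq_sum_indicator w T, collected_eq_sum_indicator (fun _ i _ => μ i) T]
  -- The cost spent through round s and the set for round s+1 are both known before the outcome at
  -- time s+1.
  have hm : ∀ s i, MeasurableSet[past r c (s + 1)]
      {ω | spent (a ω) (fun t i => c t i ω) s ≤ B ∧ i ∈ a ω (s + 1)} := fun s i =>
    measurableSet_spent_le_and_mem (m := past r c (s + 1))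
      (fun u hu => measurable_past_cost (Nat.lt_succ_of_le hu))
      (fun u hu i => past_mono hu _ (ha u i)) i
  have hm' := fun s i => h.past_le (s + 1) _ (hm s i)
  rw [integral_finsetSum _ fun s _ => integrable_finsetSum _ fun i _ =>
      ((hw i).integrable (s + 1)).indicator (hm' s i),
    integral_finsetSum _ fun s _ => integrable_finsetSum _ fun i _ =>
      (integrable_const (μ i)).indicator (hm' s i)]
  refine Finset.sum_congr rfl fun s _ => ?_
  rw [integral_finsetSum _ fun i _ => ((hw i).integrable (s + 1)).indicator (hm' s i),
    integral_finsetSum _ fun i _ => (integrable_const (μ i)).indicator (hm' s i)]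
  exact Finset.sum_congr rfl fun i _ => (hw i).integral_indicator (hm s i)

theorem IsStochasticBandit.integrable_gain [IsProbabilityMeasure P]
    (h : IsStochasticBandit P cmin μr μc r c)
    (ha : ∀ t i, MeasurableSet {ω | i ∈ a ω t}) (hcard : ∀ ω t, (a ω (t + 1)).card = K)
    (hK : 1 ≤ K) (hB : 0 ≤ B) {T : ℕ} (hT : B < T * (K * cmin)) :
    Integrable (fun ω => gain B (a ω) (fun t i => r t i ω) (fun t i => c t i ω)) P := by
  have h1 : Integrable (fun ω => ∑ s ∈ Finset.range T,
      if spent (a ω) (fun t i => c t i ω) (s + 1) ≤ B then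
        ∑ i ∈ a ω (s + 1), r (s + 1) i ω else 0) P := by
    refine integrable_finsetSum _ fun s _ => ?_
    simp_rw [ite_sum_eq_sum_indicator (fun ω => spent (a ω) (fun t i => c t i ω) (s + 1) ≤ B)
      (fun ω => a ω (s + 1)) (r (s + 1))]
    refine integrable_finsetSum _ fun i _ =>
      ((h.isIndepOfPast_reward i).integrable (s + 1)).indicator ?_
    exact (measurableSet_le (measurable_spent (fun u _ => h.measurable_cost u) fun u _ => ha u)
      measurable_const).inter (ha (s + 1) i)
  refine h1.congr ?_
  filter_upwards [h.ae_mem] with ω hω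
  exact (gain_eq_sum_ite h.cmin_pos hω.2 (hcard ω) hK hB hT
      fun t i => r t i ω).symm

end Past

/-! ### Expected number of suboptimal rounds -/

section Deviations

variable {Ω : Type*} [mΩ : MeasurableSpace Ω] {P : Measure Ω}
  {N K : ℕ} {cmin : ℝ} {μr μc : Fin N → ℝ} {r c : ℕ → Fin N → Ω → ℝ}
  {sel : ℕ → (Fin N → EReal) → Finset (Fin N)}

theorem IsStochasticBandit.measurable_statsAt (h : IsStochasticBandit P cmin μr μc r c)
    (hsel : IsTopKRule K sel) (t : ℕ) (i : Fin N) :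
    Measurable (fun ω => (statsAt K cmin sel r c t ω).count i) ∧
      Measurable (fun ω => (statsAt K cmin sel r c t ω).rewardSum i) ∧
      Measurable (fun ω => (statsAt K cmin sel r c t ω).costSum i) :=
  BudgetedBandit.measurable_statsAt hsel (fun s _ => h.measurable_reward s)
    (fun s _ => h.measurable_cost s) i

theorem measurableSet_deviates {n : Ω → ℕ} {σ : Ω → ℝ} (hn : Measurable n) (hσ : Measurable σ)
    (t : ℕ) (m : ℝ) : MeasurableSet {ω | deviates K t (n ω) (σ ω) m} := by
  have hn' : Measurable fun ω => (n ω : ℝ) := measurable_from_top.comp hn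
  exact measurableSet_lt (hn'.const_mul _).sqrt
    (continuous_abs.measurable.comp (hσ.sub (hn'.mul_const m)))

theorem measurableSet_mem_playAt_past {Ω : Type*}
    {r c : ℕ → Fin N → Ω → ℝ} (hsel : IsTopKRule K sel) (t : ℕ) (i : Fin N) :
    MeasurableSet[past r c t] {ω | i ∈ playAt K cmin sel r c ω t} :=
  @measurableSet_mem_playAt Ω (past r c t) N K cmin sel r c hsel t
    (fun _ hs => measurable_past_reward hs) (fun _ hs => measurable_past_cost hs) i

theorem IsStochasticBandit.measurableSet_playAt_ne (h : IsStochasticBandit P cmin μr μc r c)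
    (hsel : IsTopKRule K sel) (astar : Finset (Fin N)) (t : ℕ) :
    MeasurableSet {ω | playAt K cmin sel r c ω (t + 1) ≠ astar} :=
  (measurableSet_playAt_succ_eq hsel (h.measurable_statsAt hsel t) astar).compl

theorem integral_ite_one {p : Ω → Prop} [DecidablePred p] (hp : MeasurableSet {ω | p ω}) :
    ∫ ω, (if p ω then (1 : ℝ) else 0) ∂P = P.real {ω | p ω} := by
  rw [← integral_indicator_one hp]
  exact integral_congr_ae (ae_of_all _ fun ω => by simp [Set.indicator_apply])

variable [IsProbabilityMeasure P]

/-- The observed sum of an arm deviates in round `t + 1` with probability at most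
`2 / (t + 1) ^ 2`. -/
theorem IsIndepOfPast.measure_deviates_le {ℱ : ℕ → MeasurableSpace Ω} {x : ℕ → Ω → ℝ} {m : ℝ}
    (h : IsIndepOfPast P ℱ x m) {q : ℕ → Set Ω} (hq : ∀ t, MeasurableSet[ℱ t] (q t))
    (hK : 1 ≤ K) (t : ℕ) {n : Ω → ℕ} {σ : Ω → ℝ} (hn1 : ∀ ω, 1 ≤ n ω)
    (hn : ∀ ω, (n ω : ℝ) = drawCount q (t + 1) ω)
    (hσ : ∀ ω, σ ω = ∑ s ∈ Finset.range (t + 1), (q s).indicator (x s) ω) :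
    P.real {ω | deviates K t (n ω) (σ ω) m} ≤ 2 / ((t : ℝ) + 1) ^ 2 := by
  -- The statistics used in round t+1 cover times 0 to t, which are t+1 possible draws; this matches
  -- log(t+1) in the radius.
  have hdev : ∀ ω, σ ω - n ω * m = drawDev x m q (t + 1) ω := by
    intro ω
    rw [hσ, hn, drawCount, drawDev, Finset.sum_mul, ← Finset.sum_sub_distrib]
    refine Finset.sum_congr rfl fun s _ => ?_
    by_cases hω : ω ∈ q s <;> simp [hω]
  refine ENNReal.toReal_le_of_le_ofReal (by positivity) ?_
  have h1 := h.measure_dev_log_le hq hK (t := t + 1) (by omega)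
  push_cast at h1
  refine (measure_mono ?_).trans h1
  intro ω hω
  rw [Set.mem_ofPred_eq, deviates, hdev, hn] at hω
  refine ⟨?_, by exact_mod_cast hω⟩
  rw [← hn]
  exact_mod_cast hn1 ω

/-- Telescoping, as 1/(t+1)² ≤ 2/((t+1)(t+2)). -/
theorem sum_inv_sq_le (T : ℕ) : ∑ t ∈ Finset.range T, 1 / ((t : ℝ) + 1) ^ 2 ≤ 2 := by
  suffices h : ∑ t ∈ Finset.range T, 1 / ((t : ℝ) + 1) ^ 2 ≤ 2 - 2 / ((T : ℝ) + 1) by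
    have : 0 ≤ 2 / ((T : ℝ) + 1) := by positivity
    linarith
  induction T with
  | zero => norm_num
  | succ T ih =>
    rw [Finset.sum_range_succ]
    have h : 1 / ((T : ℝ) + 1) ^ 2 ≤ 2 / ((T : ℝ) + 1) - 2 / (((T + 1 : ℕ) : ℝ) + 1) := by
      push_cast
      rw [div_sub_div _ _ (by positivity) (by positivity), div_le_div_iff₀ (by positivity)
        (by positivity)]
      have : (0 : ℝ) ≤ T := T.cast_nonneg
      nlinarith [mul_nonneg this this, mul_nonneg this (mul_nonneg this this)]
    linarith

theorem integrable_ite_one {p : Ω → Prop} [DecidablePred p] (hp : MeasurableSet {ω | p ω}) :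
    Integrable (fun ω => if p ω then (1 : ℝ) else 0) P :=
  ((integrable_const (1 : ℝ)).indicator hp).congr
    (ae_of_all _ fun ω => by simp [Set.indicator_apply])

/-- The expected number of suboptimal rounds among the first `T` is logarithmic. -/
theorem IsStochasticBandit.integral_suboptimal_le (h : IsStochasticBandit P cmin μr μc r c)
    (hsel : IsTopKRule K sel) (hK : 1 ≤ K) {astar : Finset (Fin N)} (hcard : astar.card = K)
    (hgap : 0 < gapMin K (ratio μr μc) astar) (T : ℕ) :
    ∫ ω, (∑ t ∈ Finset.range T,
      if playAt K cmin sel r c ω (t + 1) ≠ astar then (1 : ℝ) else 0) ∂P ≤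
      N * (((K : ℝ) + 1) * Real.log T / radius cmin (gapMin K (ratio μr μc) astar) ^ 2 + 8) := by
  classical
  set l := ((K : ℝ) + 1) * Real.log T / radius cmin (gapMin K (ratio μr μc) astar) ^ 2 with hl
  have hm := h.measurable_statsAt (cmin := cmin) hsel
  have hmr := fun t i => measurableSet_deviates (K := K) (hm t i).1 (hm t i).2.1 t (μr i)
  have hmc := fun t i => measurableSet_deviates (K := K) (hm t i).1 (hm t i).2.2 t (μc i)
  have hir := fun t i => integrable_ite_one (P := P) (hmr t i)
  have hic := fun t i => integrable_ite_one (P := P) (hmc t i)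
  have hi : ∀ t i, Integrable (fun ω =>
      (if deviates K t ((statsAt K cmin sel r c t ω).count i)
          ((statsAt K cmin sel r c t ω).rewardSum i) (μr i) then (1 : ℝ) else 0) +
        (if deviates K t ((statsAt K cmin sel r c t ω).count i)
          ((statsAt K cmin sel r c t ω).costSum i) (μc i) then (1 : ℝ) else 0)) P :=
    fun t i => (hir t i).add (hic t i)
  have hq : ∀ i t, MeasurableSet[past r c t] {ω | i ∈ playAt K cmin sel r c ω t} :=
    fun i t => measurableSet_mem_playAt_past hsel t i
  have hcount : ∀ t i ω, ((statsAt K cmin sel r c t ω).count i : ℝ) =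
      drawCount (fun t => {ω | i ∈ playAt K cmin sel r c ω t}) (t + 1) ω := by
    intro t i ω
    rw [statsAt, ucbStats_count]
    exact Finset.sum_congr rfl fun s _ => by simp [Set.indicator_apply]
  have hPr : ∀ t i, P.real {ω | deviates K t ((statsAt K cmin sel r c t ω).count i)
      ((statsAt K cmin sel r c t ω).rewardSum i) (μr i)} ≤ 2 / ((t : ℝ) + 1) ^ 2 := by
    intro t i
    refine (h.isIndepOfPast_reward i).measure_deviates_le (hq i) hK t
      (fun ω => one_le_ucbStats_count t i) (hcount t i) fun ω => ?_
    rw [statsAt, ucbStats_rewardSum]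
    exact Finset.sum_congr rfl fun s _ => by simp [Set.indicator_apply]
  have hPc : ∀ t i, P.real {ω | deviates K t ((statsAt K cmin sel r c t ω).count i)
      ((statsAt K cmin sel r c t ω).costSum i) (μc i)} ≤ 2 / ((t : ℝ) + 1) ^ 2 := by
    intro t i
    refine (h.isIndepOfPast_cost i).measure_deviates_le (hq i) hK t
      (fun ω => one_le_ucbStats_count t i) (hcount t i) fun ω => ?_
    rw [statsAt, ucbStats_costSum]
    exact Finset.sum_congr rfl fun s _ => by simp [Set.indicator_apply]
  have hbound : ∀ᵐ ω ∂P, (∑ t ∈ Finset.range T,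
      if playAt K cmin sel r c ω (t + 1) ≠ astar then (1 : ℝ) else 0) ≤
      N * l + ∑ t ∈ Finset.range T, ∑ i,
        ((if deviates K t ((statsAt K cmin sel r c t ω).count i)
          ((statsAt K cmin sel r c t ω).rewardSum i) (μr i) then (1 : ℝ) else 0) +
        (if deviates K t ((statsAt K cmin sel r c t ω).count i)
          ((statsAt K cmin sel r c t ω).costSum i) (μc i) then (1 : ℝ) else 0)) := by
    filter_upwards [h.ae_mem] with ω hω
    convert sum_suboptimal_le h.cmin_pos h.mean_reward_mem (fun i => (h.mean_cost_mem i).1) hcard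
      hgap hsel hω.2 T using 4
  have hsum := integrable_finsetSum (Finset.range T) fun t _ =>
    integrable_finsetSum Finset.univ fun i _ => hi t i
  refine (integral_mono_ae (integrable_finsetSum _ fun t _ =>
    integrable_ite_one (h.measurableSet_playAt_ne hsel astar t))
    ((integrable_const (N * l)).add hsum) hbound).trans ?_
  simp only [Pi.add_apply]
  rw [integral_add (integrable_const _) hsum, integral_const, integral_finsetSum _ fun t _ =>
    integrable_finsetSum Finset.univ fun i _ => hi t i]
  -- Per arm, the reward and the cost mean each contribute 2/(t+1)²; summing over t then gives the
  -- constant 8 per arm.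
  have hterm : ∀ t ∈ Finset.range T, ∫ ω, ∑ i,
        ((if deviates K t ((statsAt K cmin sel r c t ω).count i)
          ((statsAt K cmin sel r c t ω).rewardSum i) (μr i) then (1 : ℝ) else 0) +
        (if deviates K t ((statsAt K cmin sel r c t ω).count i)
          ((statsAt K cmin sel r c t ω).costSum i) (μc i) then (1 : ℝ) else 0)) ∂P ≤
      4 * N * (1 / ((t : ℝ) + 1) ^ 2) := by
    intro t _
    rw [integral_finsetSum _ fun i _ => hi t i]
    refine (Finset.sum_le_card_nsmul _ _ (4 * (1 / ((t : ℝ) + 1) ^ 2)) fun i _ => ?_).trans ?_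
    · rw [integral_add (hir t i) (hic t i), integral_ite_one (hmr t i), integral_ite_one (hmc t i)]
      refine (add_le_add (hPr t i) (hPc t i)).trans (le_of_eq ?_)
      ring
    · simp only [Finset.card_univ, Fintype.card_fin, nsmul_eq_mul]
      exact le_of_eq (by ring)
  have h2 := Finset.sum_le_sum hterm
  rw [← Finset.mul_sum] at h2
  have h3 := mul_le_mul_of_nonneg_left (sum_inv_sq_le T) (show (0 : ℝ) ≤ 4 * N by positivity)
  simp only [probReal_univ, one_smul]
  linarith

end Deviations

/-! ### Bounds on the two gains and on the regret -/

section Regret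

variable {Ω : Type*} [mΩ : MeasurableSpace Ω] {P : Measure Ω} [IsProbabilityMeasure P]
  {N K : ℕ} {cmin B : ℝ} {μr μc : Fin N → ℝ} {r c : ℕ → Fin N → Ω → ℝ}
  {sel : ℕ → (Fin N → EReal) → Finset (Fin N)} {astar : Finset (Fin N)}

theorem rate_mem_Icc (hcm : 0 < cmin) (hK : 1 ≤ K) (hμr : ∀ i, μr i ∈ Set.Icc (0 : ℝ) 1)
    (hμc : ∀ i, μc i ∈ Set.Icc cmin 1) (hcard : astar.card = K) :
    (∑ i ∈ astar, μr i) / (∑ i ∈ astar, μc i) ∈ Set.Icc 0 (1 / cmin) := by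
  have hK0 : (0 : ℝ) < K := by exact_mod_cast hK
  have h1 := sum_mem_Icc hcard hμr
  have h2 := sum_mem_Icc hcard hμc
  have h3 : 0 < K * cmin := by positivity
  refine ⟨div_nonneg (by simpa using h1.1) (h3.le.trans h2.1), ?_⟩
  refine (div_le_div₀ hK0.le h1.2 h3 h2.1).trans (le_of_eq ?_)
  field_simp

/-- For constant play, mean reward is the fixed multiple ρ of mean cost in each round, and the
expected collected cost is at most B+K. -/
theorem integral_optGain_le (h : IsStochasticBandit P cmin μr μc r c) (hK : 1 ≤ K) (hB : 0 ≤ B)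
    (hcard : astar.card = K) :
    Integrable (optGain astar r c B) P ∧ ∫ ω, optGain astar r c B ω ∂P ≤
      (∑ i ∈ astar, μr i) / (∑ i ∈ astar, μc i) * (B + K) := by
  have hcm := h.cmin_pos
  have hpos : 0 < (K : ℝ) * cmin := mul_pos (by exact_mod_cast hK) hcm
  obtain ⟨T, hT⟩ := exists_nat_gt (B / (K * cmin))
  rw [div_lt_iff₀ hpos] at hT
  have ha : ∀ (ω : Ω) (t : ℕ), ((fun (_ : Ω) (_ : ℕ) => astar) ω (t + 1)).card = K :=
    fun _ _ => hcard
  have hm : ∀ (t : ℕ) (i : Fin N), MeasurableSet[past r c t] {_ω : Ω | i ∈ astar} := fun t i =>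
    @MeasurableSet.const Ω (past r c t) _
  have hgi := h.integrable_gain (a := fun _ _ => astar) (fun t i => h.past_le t _ (hm t i)) ha hK
    hB hT
  refine ⟨hgi, ?_⟩
  have hrate := rate_mem_Icc hcm hK h.mean_reward_mem h.mean_cost_mem hcard
  have hC0 : 0 < ∑ i ∈ astar, μc i := hpos.trans_le (sum_mem_Icc hcard h.mean_cost_mem).1
  have hcoll := fun {w : ℕ → Fin N → Ω → ℝ} (hw : ∀ t i, Integrable (w t i) P) =>
    h.integrable_collected (B := B) (a := fun _ _ => astar) (fun t i => h.past_le t _ (hm t i)) hw T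
  have h1 : ∫ ω, optGain astar r c B ω ∂P ≤ ∫ ω, collected B (fun _ => astar)
      (fun t i => c t i ω) (fun t i => r t i ω) T ∂P := by
    refine integral_mono_ae hgi (hcoll fun t i => (h.isIndepOfPast_reward i).integrable t) ?_
    filter_upwards [h.ae_mem] with ω hω
    exact sub_nonneg.1 (collected_eq_gain_add hcm hω.2 (ha ω) hK hB hT _ hω.1).1
  refine h1.trans ?_
  rw [h.integral_collected (a := fun _ _ => astar) hm h.isIndepOfPast_reward]
  have h2 : ∀ ω, collected B (fun _ => astar) (fun t i => c t i ω) (fun _ i => μr i) T =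
      (∑ i ∈ astar, μr i) / (∑ i ∈ astar, μc i) *
        collected B (fun _ => astar) (fun t i => c t i ω) (fun _ i => μc i) T := by
    intro ω
    unfold collected
    rw [Finset.mul_sum]
    refine Finset.sum_congr rfl fun s _ => ?_
    split_ifs
    · field_simp
    · simp
  simp_rw [h2]
  rw [integral_const_mul, ← h.integral_collected (a := fun _ _ => astar) hm h.isIndepOfPast_cost]
  refine mul_le_mul_of_nonneg_left ?_ hrate.1
  refine (integral_mono_ae (hcoll fun t i => (h.isIndepOfPast_cost i).integrable t)
    (integrable_const (B + K)) ?_).trans (by simp)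
  filter_upwards [h.ae_mem] with ω hω
  exact (collected_cost_mem hcm hω.2 (ha ω) hK hB hT).2

theorem le_integral_ucbGain (h : IsStochasticBandit P cmin μr μc r c) (hsel : IsTopKRule K sel)
    (hK : 1 ≤ K) (hB : 0 ≤ B) (hcard : astar.card = K) {T : ℕ} (hT : B < T * (K * cmin)) :
    Integrable (ucbGain K cmin sel r c B) P ∧
      (∑ i ∈ astar, μr i) / (∑ i ∈ astar, μc i) * (B - K * ∫ ω, (∑ t ∈ Finset.range T,
        if playAt K cmin sel r c ω (t + 1) ≠ astar then (1 : ℝ) else 0) ∂P) - K ≤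
      ∫ ω, ucbGain K cmin sel r c B ω ∂P := by
  have hcm := h.cmin_pos
  have hpos : 0 < (K : ℝ) * cmin := mul_pos (by exact_mod_cast hK) hcm
  have ha : ∀ (ω : Ω) (t : ℕ), (playAt K cmin sel r c ω (t + 1)).card = K :=
    fun _ t => ucbPlay_succ_card hsel t
  have hm : ∀ (t : ℕ) (i : Fin N), MeasurableSet[past r c t]
      {ω : Ω | i ∈ playAt K cmin sel r c ω t} :=
    measurableSet_mem_playAt_past hsel
  have hgi := h.integrable_gain (fun t i => h.past_le t _ (hm t i)) ha hK hB hT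
  refine ⟨hgi, ?_⟩
  have hrate := rate_mem_Icc hcm hK h.mean_reward_mem h.mean_cost_mem hcard
  have hC0 : 0 < ∑ i ∈ astar, μc i := hpos.trans_le (sum_mem_Icc hcard h.mean_cost_mem).1
  have hcoll := fun {w : ℕ → Fin N → Ω → ℝ} (hw : ∀ t i, Integrable (w t i) P) =>
    h.integrable_collected (B := B) (fun t i => h.past_le t _ (hm t i)) hw T
  have h1 : ∫ ω, (collected B (playAt K cmin sel r c ω)
      (fun t i => c t i ω) (fun t i => r t i ω) T - K) ∂P ≤
      ∫ ω, ucbGain K cmin sel r c B ω ∂P := by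
    refine integral_mono_ae ((hcoll fun t i => (h.isIndepOfPast_reward i).integrable t).sub
      (integrable_const _)) hgi ?_
    filter_upwards [h.ae_mem] with ω hω
    exact sub_le_comm.1 (collected_eq_gain_add hcm hω.2 (ha ω) hK hB hT _ hω.1).2
  refine le_trans ?_ h1
  rw [integral_sub (hcoll fun t i => (h.isIndepOfPast_reward i).integrable t)
    (integrable_const _), h.integral_collected hm h.isIndepOfPast_reward]
  have hsub : Integrable (fun ω => ∑ t ∈ Finset.range T,
      if playAt K cmin sel r c ω (t + 1) ≠ astar then (1 : ℝ) else 0) P :=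
    integrable_finsetSum _ fun t _ => integrable_ite_one (h.measurableSet_playAt_ne hsel astar t)
  set ρ := (∑ i ∈ astar, μr i) / (∑ i ∈ astar, μc i) with hρ
  -- Round by round: equality when `astar` is played; otherwise mean cost minus K is nonpositive
  -- while mean reward is nonnegative.
  have h2 : ∀ ω, ρ * (collected B (playAt K cmin sel r c ω) (fun t i => c t i ω)
        (fun _ i => μc i) T - K * ∑ t ∈ Finset.range T,
        if playAt K cmin sel r c ω (t + 1) ≠ astar then (1 : ℝ) else 0) ≤
      collected B (playAt K cmin sel r c ω) (fun t i => c t i ω) (fun _ i => μr i) T := by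
    intro ω
    unfold collected
    rw [Finset.mul_sum, ← Finset.sum_sub_distrib, Finset.mul_sum]
    refine Finset.sum_le_sum fun s _ => ?_
    by_cases hs : playAt K cmin sel r c ω (s + 1) = astar
    · rw [hs]
      split_ifs
      · simp_all
      · refine le_of_eq ?_
        rw [hρ]
        field_simp
        ring
      · simp_all
      · simp
    · have h3 := sum_mem_Icc (ha ω s) h.mean_reward_mem
      have h4 := sum_mem_Icc (ha ω s) h.mean_cost_mem
      rw [if_pos hs]
      split_ifs
      · refine le_trans (mul_nonpos_of_nonneg_of_nonpos hrate.1 ?_) (by simpa using h3.1)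
        linarith [h4.2]
      · refine mul_nonpos_of_nonneg_of_nonpos hrate.1 ?_
        simp
  have hci := hcoll fun _ i => integrable_const (μc i)
  have h5 := integral_mono ((hci.sub (hsub.const_mul (K : ℝ))).const_mul ρ)
    (hcoll fun _ i => integrable_const (μr i)) h2
  simp only [Pi.sub_apply] at h5
  rw [integral_const_mul, integral_sub hci (hsub.const_mul (K : ℝ)), integral_const_mul,
    ← h.integral_collected hm h.isIndepOfPast_cost] at h5
  have h6 : B ≤ ∫ ω, collected B (playAt K cmin sel r c ω) (fun t i => c t i ω)
      (fun t i => c t i ω) T ∂P := by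
    refine le_trans (by simp) (integral_mono_ae (integrable_const B)
      (hcoll fun t i => (h.isIndepOfPast_cost i).integrable t) ?_)
    filter_upwards [h.ae_mem] with ω hω
    exact (collected_cost_mem hcm hω.2 (ha ω) hK hB hT).1
  have h7 := mul_le_mul_of_nonneg_left h6 hrate.1
  simp only [integral_const, probReal_univ, one_smul]
  linarith

theorem regret_le (h : IsStochasticBandit P cmin μr μc r c) (hsel : IsTopKRule K sel)
    (hK : 1 ≤ K) (hB : 0 < B) (hcm1 : cmin ≤ 1) (hcard : astar.card = K)
    (hgap : 0 < gapMin K (ratio μr μc) astar) :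
    regret P K cmin sel astar r c B ≤ K + K / cmin * (1 + N * (((K : ℝ) + 1) *
      (Real.log (B + 1) - Real.log cmin) /
        radius cmin (gapMin K (ratio μr μc) astar) ^ 2 + 8)) := by
  have hcm := h.cmin_pos
  have hK1 : (1 : ℝ) ≤ K := by exact_mod_cast hK
  have hpos : 0 < (K : ℝ) * cmin := by positivity
  -- A deterministic horizon that the game cannot outlast. It is at most (B+1)/cmin because K ≥ 1
  -- and cmin ≤ 1.
  set T := ⌊B / (K * cmin)⌋₊ + 1 with hTdef
  have hT : B < T * (K * cmin) := by
    rw [← div_lt_iff₀ hpos, hTdef]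
    exact_mod_cast Nat.lt_floor_add_one (B / (K * cmin))
  have hTle : (T : ℝ) ≤ (B + 1) / cmin := by
    rw [hTdef]
    push_cast
    have h1 := Nat.floor_le (show 0 ≤ B / (K * cmin) by positivity)
    have h2 : B / (K * cmin) ≤ B / cmin :=
      div_le_div_of_nonneg_left hB.le hcm (by nlinarith)
    have h3 : 1 ≤ 1 / cmin := by rwa [le_div_iff₀ hcm, one_mul]
    rw [add_div]
    linarith
  have hT0 : (0 : ℝ) < T := by
    rw [hTdef]
    positivity
  have hlog : Real.log T ≤ Real.log (B + 1) - Real.log cmin := by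
    rw [← Real.log_div (by positivity) hcm.ne']
    exact Real.log_le_log hT0 hTle
  have hrad := radius_pos hcm hgap
  have hrate := rate_mem_Icc hcm hK h.mean_reward_mem h.mean_cost_mem hcard
  have h1 := (integral_optGain_le h hK hB.le hcard).2
  have h2 := (le_integral_ucbGain h hsel hK hB.le hcard hT).2
  have h3 := h.integral_suboptimal_le (cmin := cmin) hsel hK hcard hgap T
  set E := ∫ ω, (∑ t ∈ Finset.range T,
    if playAt K cmin sel r c ω (t + 1) ≠ astar then (1 : ℝ) else 0) ∂P with hE
  set ρ := (∑ i ∈ astar, μr i) / (∑ i ∈ astar, μc i) with hρ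
  set δ := radius cmin (gapMin K (ratio μr μc) astar) with hδ
  have h4 : E ≤ N * (((K : ℝ) + 1) * (Real.log (B + 1) - Real.log cmin) / δ ^ 2 + 8) := by
    refine h3.trans ?_
    gcongr
  have hE0 : 0 ≤ E := integral_nonneg fun ω => Finset.sum_nonneg fun t _ => by
    split_ifs <;> norm_num
  have h5 : ρ * (K * (1 + E)) ≤ 1 / cmin * (K * (1 + E)) :=
    mul_le_mul_of_nonneg_right hrate.2 (by positivity)
  have h6 : 1 / cmin * (K * (1 + E)) ≤ K / cmin * (1 + N * (((K : ℝ) + 1) *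
      (Real.log (B + 1) - Real.log cmin) / δ ^ 2 + 8)) := by
    rw [← mul_assoc, one_div_mul_eq_div]
    gcongr
  unfold regret
  linarith

end Regret

end BudgetedBandit
end

/-! ### Choice of constants -/

open BudgetedBandit in
theorem theorem1 :
    ∃ (c₁ c₂ c₃ : (N : ℕ) → (K : ℕ) → (cmin Δmin : ℝ) → (μr μc : Fin N → ℝ) → ℝ)
      (C : (cmin Δmin : ℝ) → ℝ),
    ∀ (N K : ℕ) (_ : 1 ≤ K) (_ : K ≤ N) (cmin Δmin : ℝ) (μr μc : Fin N → ℝ)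
      (astar : Finset (Fin N))
      (_ : BudgetedBandit.IsTopK K (BudgetedBandit.ratio μr μc) astar)
      (_ : Δmin = BudgetedBandit.gapMin K (BudgetedBandit.ratio μr μc) astar)
      (_ : 0 < Δmin)
      (Ω : Type*) (_ : MeasurableSpace Ω) (P : MeasureTheory.Measure Ω)
      (_ : MeasureTheory.IsProbabilityMeasure P)
      (r c : ℕ → Fin N → Ω → ℝ)
      (_ : BudgetedBandit.IsStochasticBandit P cmin μr μc r c)
      (sel : ℕ → (Fin N → EReal) → Finset (Fin N))
      (_ : BudgetedBandit.IsTopKRule K sel),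
      0 < c₁ N K cmin Δmin μr μc ∧ 0 < c₂ N K cmin Δmin μr μc ∧ 0 < c₃ N K cmin Δmin μr μc ∧
      (∀ B : ℝ, 0 < B →
        MeasureTheory.Integrable (BudgetedBandit.optGain astar r c B) P ∧
        MeasureTheory.Integrable (BudgetedBandit.ucbGain K cmin sel r c B) P ∧
        BudgetedBandit.regret P K cmin sel astar r c B ≤
          c₁ N K cmin Δmin μr μc +
            c₂ N K cmin Δmin μr μc * Real.log (B + c₃ N K cmin Δmin μr μc)) ∧
      (∀ B : ℝ, 2 ≤ B →
        c₁ N K cmin Δmin μr μc +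
            c₂ N K cmin Δmin μr μc * Real.log (B + c₃ N K cmin Δmin μr μc) ≤
          C cmin Δmin * ((N : ℝ) * (K : ℝ) ^ 4 * Real.log B)) := by
  -- The bound of `regret_le`, sorted by powers of log(B+1): the summand -log cmin goes into c₁, and
  -- c₃ = 1. The outer factors 2 in C come from 1 ≤ 2 log B and log(B+1) ≤ 2 log B for B ≥ 2.
  refine ⟨fun N K cmin Δ _ _ => K + K / cmin *
      (1 + N * (((K : ℝ) + 1) * (-Real.log cmin) / radius cmin Δ ^ 2 + 8)),
    fun N K cmin Δ _ _ => K / cmin * (N * (((K : ℝ) + 1) / radius cmin Δ ^ 2)),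
    fun _ _ _ _ _ _ => 1,
    fun cmin Δ => 2 * (1 + 1 / cmin * (9 + 2 * (-Real.log cmin) / radius cmin Δ ^ 2)) +
      2 * (1 / cmin * (2 / radius cmin Δ ^ 2)), ?_⟩
  intro N K hK hKN cmin Δ μr μc astar htop hΔ hΔ0 Ω _ P _ r c h sel hsel
  have hcm := h.cmin_pos
  have hN : 1 ≤ N := hK.trans hKN
  have hcm1 : cmin ≤ 1 := by
    have := h.mean_cost_mem ⟨0, hN⟩
    exact this.1.trans this.2
  have hlog : 0 ≤ -Real.log cmin := neg_nonneg.2 (Real.log_nonpos hcm.le hcm1)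
  have hrad := radius_pos hcm hΔ0
  have hK1 : (1 : ℝ) ≤ K := by exact_mod_cast hK
  have hN1 : (1 : ℝ) ≤ N := by exact_mod_cast hN
  have hgap : 0 < gapMin K (ratio μr μc) astar := hΔ ▸ hΔ0
  refine ⟨by positivity, by positivity, one_pos, fun B hB => ⟨?_, ?_, ?_⟩, fun B hB => ?_⟩
  · exact (integral_optGain_le h hK hB.le htop.1).1
  · obtain ⟨T, hT⟩ := exists_nat_gt (B / (K * cmin))
    rw [div_lt_iff₀ (by positivity)] at hT
    exact (le_integral_ucbGain h hsel hK hB.le htop.1 hT).1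
  · refine (regret_le h hsel hK hB hcm1 htop.1 hgap).trans (le_of_eq ?_)
    rw [hΔ]
    ring
  · have hL : 1 / 2 ≤ Real.log B :=
      (by linarith [Real.log_two_gt_d9] : 1 / 2 ≤ Real.log 2).trans
        (Real.log_le_log two_pos hB)
    -- For B ≥ 2 one has B + 1 ≤ B².
    have hL2 : Real.log (B + 1) ≤ 2 * Real.log B := by
      rw [show 2 * Real.log B = Real.log (B ^ 2) by rw [Real.log_pow]; norm_num]
      exact Real.log_le_log (by linarith) (by nlinarith)
    simp only
    generalize radius cmin Δ = δ at *
    generalize -Real.log cmin = v at *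
    generalize Real.log B = L at *
    -- The constants grow only like N K²; the fourth power leaves room to spare.
    have hK4 : (K : ℝ) ^ 2 ≤ K ^ 4 := pow_le_pow_right₀ hK1 (by norm_num)
    have hKK : (K : ℝ) ≤ K ^ 2 := by nlinarith
    have hKM : (K : ℝ) ≤ N * K ^ 4 := by nlinarith
    have hNKM : (K : ℝ) * N ≤ N * K ^ 4 := by nlinarith
    have hNKKM : (K : ℝ) * (N * (K + 1)) ≤ 2 * (N * K ^ 4) := by nlinarith
    generalize (N : ℝ) * (K : ℝ) ^ 4 = M at *
    have hM : 0 ≤ M := by linarith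
    have hc₁ : (K : ℝ) + K / cmin * (1 + N * ((K + 1) * v / δ ^ 2 + 8)) ≤
        M * (1 + 1 / cmin * (9 + 2 * v / δ ^ 2)) := by
      have h1 : (K : ℝ) + K / cmin * (1 + N * ((K + 1) * v / δ ^ 2 + 8)) =
          K + 1 / cmin * (K + (K * (N * (K + 1))) * (v / δ ^ 2) + 8 * (K * N)) := by
        field_simp
        ring
      have h2 : M * (1 + 1 / cmin * (9 + 2 * v / δ ^ 2)) =
          M + 1 / cmin * (M + (2 * M) * (v / δ ^ 2) + 8 * M) := by
        ring
      rw [h1, h2]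
      gcongr
    have hc₂ : (K : ℝ) / cmin * (N * ((K + 1) / δ ^ 2)) ≤ M * (1 / cmin * (2 / δ ^ 2)) := by
      have h1 : (K : ℝ) / cmin * (N * ((K + 1) / δ ^ 2)) =
          1 / cmin * ((K * (N * (K + 1))) / δ ^ 2) := by
        ring
      have h2 : M * (1 / cmin * (2 / δ ^ 2)) = 1 / cmin * ((2 * M) / δ ^ 2) := by
        ring
      rw [h1, h2]
      gcongr
    have hA : 0 ≤ M * (1 + 1 / cmin * (9 + 2 * v / δ ^ 2)) := by positivity
    have hc₂0 : 0 ≤ (K : ℝ) / cmin * (N * ((K + 1) / δ ^ 2)) := by positivity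
    calc _ ≤ M * (1 + 1 / cmin * (9 + 2 * v / δ ^ 2)) * (2 * L) +
          M * (1 / cmin * (2 / δ ^ 2)) * (2 * L) := by
          refine add_le_add (hc₁.trans (le_mul_of_one_le_right hA (by linarith))) ?_
          exact (mul_le_mul_of_nonneg_left hL2 hc₂0).trans
            (mul_le_mul_of_nonneg_right hc₂ (by linarith))
      _ = _ := by ring
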